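/- Let $(X,\Sigma,P)$ be a probability space. Consider filtrations $\mathcal F=(\mathcal F_n)_{n\ge 0}$ on it with $\mathcal F_0=\{\varnothing,X\}$ and with every $\sigma$-algebra $\mathcal F_n$ finite, and real-valued martingales $\varphi=(\varphi_n)_{n\ge0}$ with respect to such filtrations. Write $$S\varphi=\Big(\sum_{n\ge 0}(\varphi_{n+1}-\varphi_n)^2\Big)^{1/2}\in[0,\infty],\qquad \varphi_\infty=\lim_{n\to\infty}\varphi_n \ \text{ a.s.}$$ (the limit exists for the martingales used below), and call $\varphi$ simple if there is an $N$ with $\varphi_{n+1}=\varphi_n$ almost surely for all $n\ge N$. For an integrable $\psi\colon[0,1]\to\mathbb R$ put $$\|\psi\|_{\mathrm{BMO}([0,1])}=\sup_{J}\Big(\frac1{|J|}\int_J\Big(\psi(t)-\frac1{|J|}\int_J\psi\Big)^2dt\Big)^{1/2},$$ where $J$ runs over the non-degenerate subintervals of $[0,1]$. Let $f\colon\mathbb R\to[0,\infty)$ be Borel measurable. For real $x,y$ and $z\ge0$ let $$\boldsymbol B(x,y,z)=\sup\big\{\mathbb E H_f\big(\varphi_\infty,(S\varphi)^2+z^2\big)\;\big|\;\varphi\text{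 a simple martingale},\ \mathbb E\varphi_\infty=x,\ \mathbb E\varphi_\infty^2=y\big\},$$ where $H_f(s,t)=f(s)$ for $t\in[0,1]$ and $H_f(s,t)=-\infty$ for $t\notin[0,1]$ (over all simple martingales with respect to all filtrations as above), and for $\varepsilon\ge 0$ let $$b_\varepsilon(x,y)=\sup\Big\{\int_0^1 f(\psi)\;\Big|\;\psi\in L^1([0,1]),\ \int_0^1\psi=x,\ \int_0^1\psi^2=y,\ \|\psi\|_{\mathrm{BMO}([0,1])}\le\varepsilon\Big\}.$$ All suprema are taken in $[-\infty,+\infty]$. Let $$\Omega=\{(x,y,z)\in\mathbb R^3\mid x^2\le y\le 1-z^2+x^2,\ z\in[0,1]\}.$$ Then: (1) $\boldsymbol B(x,y,z)\le b_{\sqrt{1-z^2}}(x,y)$ for every $(x,y,z)\in\Omega$. (2) For every $x\in\mathbb R$, $$\sup\Big\{\mathbb E f(\varphi_\infty)\;\Big|\;\varphi\text{ a martingale},\ \varphi_0=x,\ S\varphi\le 1\text{ a.s.}\Big\}\le\sup\Big\{\int_0^1 f(\psi)\;\Big|\;\psi\in L^1([0,1]),\ \int_0^1\psi=x,\ \|\psi\|_{\mathrm{BMO}([0,1])}\le1\Big\},$$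 where the martingales on the left are not required to be simple. -/

import Mathlib

open MeasureTheory Filter Topology
open scoped ENNReal

namespace SquareBellman

noncomputable section

/-! ### Martingales and square functions -/

/-- The filtrations under consideration: `ℱ 0` is the trivial σ-algebra and every `ℱ n` consists
of finitely many sets. -/
def IsFiniteFiltration {X : Type*} {m : MeasurableSpace X} (ℱ : Filtration ℕ m) : Prop :=
  ℱ 0 = ⊥ ∧ ∀ n, {s : Set X | MeasurableSet[ℱ n] s}.Finite

/-- A process is simple if, from some moment on, `φ (n+1) = φ n` (almost surely). -/
def IsSimple {X : Type*} {m : MeasurableSpace X} (P : Measure X) (φ : ℕ → X → ℝ) : Prop :=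
  ∃ N : ℕ, ∀ n, N ≤ n → φ (n + 1) =ᵐ[P] φ n

/-- The square function `S φ = (∑ₙ (φ (n+1) - φ n)²)^(1/2)`, with values in `[0, ∞]`. -/
def squareFunction {X : Type*} (φ : ℕ → X → ℝ) (ω : X) : ℝ≥0∞ :=
  (∑' n : ℕ, ENNReal.ofReal ((φ (n + 1) ω - φ n ω) ^ 2)) ^ (1 / 2 : ℝ)

/-- The limit value `φ_∞ = lim φ n`. The limit exists almost everywhere for simple martingales and
for martingales with bounded square function; `limUnder` has an arbitrary value elsewhere. -/
def terminal {X : Type*} (φ : ℕ → X → ℝ) (ω : X) : ℝ :=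
  limUnder atTop fun n => φ n ω

/-! ### The martingale Bellman function -/

/-- Expectation of an extended real function: `E Y = E Y⁺ - E Y⁻`. -/
def expectation {X : Type*} [MeasurableSpace X] (P : Measure X) (Y : X → EReal) : EReal :=
  ((∫⁻ ω, (Y ω).toENNReal ∂P : ℝ≥0∞) : EReal) - ((∫⁻ ω, (-Y ω).toENNReal ∂P : ℝ≥0∞) : EReal)

open Classical in
/-- `H_f(s,t) = f(s)` for `t ∈ [0,1]` and `H_f(s,t) = -∞` otherwise. -/
def H (f : ℝ → ℝ) (s : ℝ) (t : ℝ≥0∞) : EReal :=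
  if t ∈ Set.Icc (0 : ℝ≥0∞) 1 then (f s : EReal) else ⊥

/-- The martingale Bellman function `B(x,y,z)` on the probability space `(X, P)`: the supremum of
`E H_f(φ_∞, (S φ)² + z²)` over all simple martingales `φ` with `E φ_∞ = x`, `E φ_∞² = y`. -/
def bellman {X : Type*} [m : MeasurableSpace X] (P : Measure X) (f : ℝ → ℝ) (x y z : ℝ) : EReal :=
  ⨆ (ℱ : Filtration ℕ m) (φ : ℕ → X → ℝ) (_ : IsFiniteFiltration ℱ) (_ : Martingale φ ℱ P)
    (_ : IsSimple P φ) (_ : ∫ ω, terminal φ ω ∂P = x)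
    (_ : ∫ ω, (terminal φ ω) ^ 2 ∂P = y),
    expectation P fun ω =>
      H f (terminal φ ω) (squareFunction φ ω ^ 2 + ENNReal.ofReal (z ^ 2))

/-- The domain `Ω` of the martingale Bellman function. -/
def Omega : Set (ℝ × ℝ × ℝ) :=
  {q | q.1 ^ 2 ≤ q.2.1 ∧ q.2.1 ≤ 1 - q.2.2 ^ 2 + q.1 ^ 2 ∧ q.2.2 ∈ Set.Icc (0 : ℝ) 1}

/-- The supremum of `E f(φ_∞)` over all (not necessarily simple) martingales `φ` with `φ_0 = x`
and `S φ ≤ 1` almost surely. -/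
def martingaleSup {X : Type*} [m : MeasurableSpace X] (P : Measure X) (f : ℝ → ℝ) (x : ℝ) :
    ℝ≥0∞ :=
  ⨆ (ℱ : Filtration ℕ m) (φ : ℕ → X → ℝ) (_ : IsFiniteFiltration ℱ) (_ : Martingale φ ℱ P)
    (_ : φ 0 =ᵐ[P] fun _ => x) (_ : ∀ᵐ ω ∂P, squareFunction φ ω ≤ 1),
    ∫⁻ ω, ENNReal.ofReal (f (terminal φ ω)) ∂P

/-! ### The space `BMO([0,1])` and its Bellman function -/

/-- The quadratic seminorm of `BMO([0,1])`, with values in `[0, ∞]`, for a function `ψ` that is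
integrable on `[0,1]`: the supremum over the subintervals `J = [a,b]` of `[0,1]` of the square
root of the mean over `J` of `(ψ - ψ_J)²`, where `ψ_J` is the mean of `ψ` over `J`. -/
def bmoNorm (ψ : ℝ → ℝ) : ℝ≥0∞ :=
  (⨆ (a : ℝ) (b : ℝ) (_ : 0 ≤ a) (_ : a < b) (_ : b ≤ 1),
    ⨍⁻ t in Set.Icc a b, ENNReal.ofReal ((ψ t - ⨍ u in Set.Icc a b, ψ u) ^ 2) ∂volume) ^ (1 / 2 : ℝ)

/-- The Bellman function `b_ε(x,y)`: the supremum of `∫₀¹ f(ψ)` over `ψ` with `∫₀¹ ψ = x`,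
`∫₀¹ ψ² = y` and `‖ψ‖_{BMO([0,1])} ≤ ε`. -/
def bmoBellman (f : ℝ → ℝ) (ε x y : ℝ) : EReal :=
  ⨆ (ψ : ℝ → ℝ) (_ : IntegrableOn ψ (Set.Icc 0 1)) (_ : ∫ t in Set.Icc (0 : ℝ) 1, ψ t = x)
    (_ : ∫ t in Set.Icc (0 : ℝ) 1, (ψ t) ^ 2 = y) (_ : bmoNorm ψ ≤ ENNReal.ofReal ε),
    ((∫⁻ t in Set.Icc (0 : ℝ) 1, ENNReal.ofReal (f (ψ t)) : ℝ≥0∞) : EReal)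

/-- The supremum of `∫₀¹ f(ψ)` over `ψ` with `∫₀¹ ψ = x` and `‖ψ‖_{BMO([0,1])} ≤ 1`. -/
def bmoSup (f : ℝ → ℝ) (x : ℝ) : ℝ≥0∞ :=
  ⨆ (ψ : ℝ → ℝ) (_ : IntegrableOn ψ (Set.Icc 0 1)) (_ : ∫ t in Set.Icc (0 : ℝ) 1, ψ t = x)
    (_ : bmoNorm ψ ≤ 1),
    ∫⁻ t in Set.Icc (0 : ℝ) 1, ENNReal.ofReal (f (ψ t))

end

end SquareBellman

/-!
The theorem rests on one fact about distributions: if `φ` is a martingale with `S φ ≤ √e`, then the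
increasing rearrangement of each `φ N` (the quantile function of its law) has variance at most `e`
on every subinterval of `[0,1]`. Rearrangement changes neither the integral of `f` nor the first two
moments, so this function competes in the Bellman function of `BMO([0,1])`. For the first part
`e = 1 - z²`. For the second part the terms of the martingale are bounded in `L²`, so that they
converge almost surely; their quantile functions converge almost everywhere
(`ae_tendsto_quantile_map`), and the variance bound on intervals passes to the limit by Fatou's
lemma.

A subinterval of `[0,1]` cuts a *window* out of the law: the part of it that lies in an interval,
where the atoms at the ends of the interval may be divided. Windows make sense for arbitrary weights
on a finite set of reals, and a window of a sum of weights is a sum of windows of the summands with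
common ends. Hence the fact can be proved by backward induction along the tree of the values of the
martingale (`windowVarianceLE_of_martingale`). Represent a law by the point `(E ξ, E ξ²)`. A law of
mean `v` and variance at most `e - (v - x)²` lies below the tangent to the parabola `y = x² + e` at
the abscissa `x`, and this is what is known about the branches that start from the value `x`. It
remains to show that the bound `e` for the variances of the windows is inherited by sums of weights
whose points lie below one common tangent (`WindowVarianceLE.add`).

To see this, suppose that a window of the sum of two weights has too large a variance. Its two parts
are points below the upper parabola, joined by a segment that crosses it; the tangent at some `v`,
parallel to the segment, passes below both points and touches the parabola between them. The left
part must reach down to `v - √e`: otherwise, removing its lowest atoms until its mean is `v` would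
keep it above the tangent and so produce a window of too large a variance
(`WindowVarianceLE.exists_le_of_sum_neg`). Likewise the right part reaches up to `v + √e`. So
everything outside the window is at distance at least `√e` from `v`, and putting it back moves both
parts further above the tangent; meanwhile their means cannot pass through `v`, again because a
window of mean `v` above the tangent has too large a variance
(`WindowVarianceLE.sum_pos_of_window`). In the end the two original weights are above the tangent at
`v` and on different sides of `v`, which is impossible for points below one common tangent.
-/

namespace SquareBellman

/-! ### Windows of finitely supported weights -/

/-- A weight `g` is a window of the weight `w` on the line if `0 ≤ g ≤ w` and `g` coincides with
`w` strictly between any two points that `g` charges. These are the restrictions of `w` to an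
interval, where an atom at an end of the interval may be cut into two parts. -/
structure IsWindow (w g : ℝ → ℝ) : Prop where
  nonneg : ∀ r, 0 ≤ g r
  le : ∀ r, g r ≤ w r
  eq_of_between : ∀ r₁ r₂ r₃, r₁ < r₂ → r₂ < r₃ → 0 < g r₁ → 0 < g r₃ → g r₂ = w r₂

/-- Every window of the weight `w` on the finite set `S` has variance at most `e`. The mean `u` of
a window is described by `∑ g(r)(r - u) = 0`, so no normalization is needed. -/
def WindowVarianceLE (S : Finset ℝ) (w : ℝ → ℝ) (e : ℝ) : Prop :=
  ∀ g, IsWindow w g → ∀ u, ∑ r ∈ S, g r * (r - u) = 0 → ∑ r ∈ S, g r * ((r - u) ^ 2 - e) ≤ 0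

lemma IsWindow.refl {w : ℝ → ℝ} (hw : ∀ r, 0 ≤ w r) : IsWindow w w :=
  ⟨hw, fun _ => le_rfl, fun _ _ _ _ _ _ _ => rfl⟩

lemma IsWindow.comp_neg {w g : ℝ → ℝ} (h : IsWindow w g) :
    IsWindow (fun r => w (-r)) (fun r => g (-r)) :=
  ⟨fun r => h.nonneg _, fun r => h.le _, fun r₁ r₂ r₃ h12 h23 h1 h3 =>
    h.eq_of_between (-r₃) (-r₂) (-r₁) (by linarith) (by linarith) h3 h1⟩

lemma sum_map_neg (S : Finset ℝ) (F : ℝ → ℝ) :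
    ∑ r ∈ S.map (Equiv.neg ℝ).toEmbedding, F r = ∑ r ∈ S, F (-r) := by
  simp [Finset.sum_map]

lemma WindowVarianceLE.comp_neg {S : Finset ℝ} {w : ℝ → ℝ} {e : ℝ} (h : WindowVarianceLE S w e) :
    WindowVarianceLE (S.map (Equiv.neg ℝ).toEmbedding) (fun r => w (-r)) e := by
  intro g hg u hu
  rw [sum_map_neg] at hu ⊢
  have hg' : IsWindow w (fun r => g (-r)) := by simpa using hg.comp_neg
  have := h _ hg' (-u) (by
    rw [← neg_eq_zero, ← hu, ← Finset.sum_neg_distrib]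
    exact Finset.sum_congr rfl fun r _ => by ring)
  refine le_trans (le_of_eq (Finset.sum_congr rfl fun r _ => ?_)) this
  ring

lemma WindowVarianceLE.mono {S : Finset ℝ} {w : ℝ → ℝ} {e e' : ℝ} (h : WindowVarianceLE S w e)
    (he : e ≤ e') : WindowVarianceLE S w e' := by
  intro g hg u hu
  refine le_trans (Finset.sum_le_sum fun r _ => ?_) (h g hg u hu)
  exact mul_le_mul_of_nonneg_left (by linarith) (hg.nonneg r)

/-- The intermediate value theorem for windows with a moving left end. -/
lemma IsWindow.exists_between {S : Finset ℝ} {w g₀ g₁ : ℝ → ℝ} {u : ℝ} (h₁ : IsWindow w g₁)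
    (hn : ∀ r, 0 ≤ g₀ r) (hle : ∀ r, g₀ r ≤ g₁ r)
    (hcut : ∀ r r', r < r' → 0 < g₀ r → g₀ r' = g₁ r')
    (hs₁ : ∑ r ∈ S, g₁ r * (r - u) ≤ 0) (hs₀ : 0 ≤ ∑ r ∈ S, g₀ r * (r - u)) :
    ∃ g, IsWindow w g ∧ (∀ r, g₀ r ≤ g r) ∧ (∀ r, g r ≤ g₁ r) ∧
      ∑ r ∈ S, g r * (r - u) = 0 := by
  classical
  -- windows arising from `g₁` by a left cut
  have key : ∀ g : ℝ → ℝ, (∀ r, 0 ≤ g r) → (∀ r, g r ≤ g₁ r) →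
      (∀ r r', r < r' → 0 < g r → g r' = g₁ r') → IsWindow w g := by
    intro g hg0 hg1 hc
    refine ⟨hg0, fun r => (hg1 r).trans (h₁.le r), fun r₁ r₂ r₃ h12 h23 h1 h3 => ?_⟩
    rw [hc _ _ h12 h1]
    exact h₁.eq_of_between r₁ r₂ r₃ h12 h23 (h1.trans_le (hg1 _)) (h3.trans_le (hg1 _))
  induction hD : (S.filter fun r => g₀ r ≠ g₁ r).card generalizing g₀ with
  | zero =>
    have hEq : ∀ r ∈ S, g₀ r = g₁ r := by
      rw [Finset.card_eq_zero, Finset.filter_eq_empty_iff] at hD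
      intro r hr
      simpa using hD hr
    refine ⟨g₀, key g₀ hn hle hcut, fun _ => le_rfl, hle, le_antisymm ?_ hs₀⟩
    rwa [Finset.sum_congr rfl fun r hr => by rw [hEq r hr]]
  | succ n ih =>
    set D := S.filter fun r => g₀ r ≠ g₁ r with hDdef
    have hne : D.Nonempty := Finset.card_pos.mp (by omega)
    -- the next atom to be put back is the largest one that has been cut
    set m := D.max' hne
    have hmD : m ∈ D := D.max'_mem hne
    have hmS : m ∈ S := (Finset.mem_filter.mp hmD).1
    have hm : g₀ m ≠ g₁ m := (Finset.mem_filter.mp hmD).2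
    have hbelow : ∀ r, r < m → g₀ r = 0 := by
      intro r hr
      by_contra h
      exact hm (hcut r m hr (lt_of_le_of_ne (hn r) (Ne.symm h)))
    have hab : ∀ r ∈ S, m < r → g₀ r = g₁ r := by
      intro r hrS hr
      by_contra h
      exact absurd (D.le_max' r (Finset.mem_filter.mpr ⟨hrS, h⟩)) (not_le.mpr hr)
    let G : ℝ → ℝ → ℝ := fun θ r =>
      if r < m then 0 else if r = m then g₀ m + θ * (g₁ m - g₀ m) else g₁ r
    have hdm : 0 ≤ g₁ m - g₀ m := sub_nonneg.mpr (hle m)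
    have hG0 : ∀ θ, 0 ≤ θ → ∀ r, g₀ r ≤ G θ r := by
      intro θ hθ r
      rcases lt_trichotomy r m with h | h | h
      · simp [G, h, hbelow r h]
      · subst h
        simp only [G, lt_irrefl, if_false, if_true]
        nlinarith [mul_nonneg hθ hdm]
      · simp [G, not_lt.mpr h.le, h.ne', hle r]
    have hG1 : ∀ θ, θ ≤ 1 → ∀ r, G θ r ≤ g₁ r := by
      intro θ hθ r
      rcases lt_trichotomy r m with h | h | h
      · simp [G, h, h₁.nonneg r]
      · subst h
        simp only [G, lt_irrefl, if_false, if_true]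
        nlinarith [mul_nonneg (sub_nonneg.mpr hθ) hdm]
      · simp [G, not_lt.mpr h.le, h.ne']
    have hGc : ∀ θ r r', r < r' → 0 < G θ r → G θ r' = g₁ r' := by
      intro θ r r' hr hpos
      have hmr : m ≤ r := by
        by_contra h
        simp [G, not_le.mp h] at hpos
      have : m < r' := hmr.trans_lt hr
      simp [G, not_lt.mpr this.le, this.ne']
    have hGS : ∀ θ, ∑ r ∈ S, G θ r * (r - u) =
        ∑ r ∈ S, g₀ r * (r - u) + θ * ((g₁ m - g₀ m) * (m - u)) := by
      intro θ
      have : ∀ r ∈ S, G θ r * (r - u) = g₀ r * (r - u) +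
          if m = r then θ * ((g₁ m - g₀ m) * (m - u)) else 0 := by
        intro r hr
        rcases lt_trichotomy r m with h | h | h
        · simp [G, h, hbelow r h, h.ne']
        · subst h
          simp only [G, lt_irrefl, if_false, if_true]
          ring
        · simp [G, not_lt.mpr h.le, h.ne', h.ne, hab r hr h]
      rw [Finset.sum_congr rfl this, Finset.sum_add_distrib, Finset.sum_ite_eq, if_pos hmS]
    set s := ∑ r ∈ S, g₀ r * (r - u)
    set c := (g₁ m - g₀ m) * (m - u)
    rcases le_total (s + c) 0 with hc | hc
    · obtain ⟨θ, hθ0, hθ1, hθ⟩ : ∃ θ : ℝ, 0 ≤ θ ∧ θ ≤ 1 ∧ s + θ * c = 0 := by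
        rcases hs₀.eq_or_lt with h0 | h0
        · exact ⟨0, le_rfl, zero_le_one, by rw [← h0]; ring⟩
        · have hc' : c < 0 := by linarith
          refine ⟨s / (-c), div_nonneg hs₀ (by linarith), ?_, ?_⟩
          · rw [div_le_one (by linarith)]; linarith
          · field_simp [hc'.ne]
            ring
      exact ⟨G θ, key _ (fun r => (hn r).trans (hG0 θ hθ0 r)) (hG1 θ hθ1) (hGc θ), hG0 θ hθ0,
        hG1 θ hθ1, by rw [hGS, hθ]⟩
    · have hcard : (S.filter fun r => G 1 r ≠ g₁ r).card = n := by
        have : (S.filter fun r => G 1 r ≠ g₁ r) = D.erase m := by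
          ext r
          simp only [Finset.mem_filter, Finset.mem_erase, hDdef]
          rcases lt_trichotomy r m with h | h | h
          · simp [G, h, hbelow r h, h.ne]
          · subst h
            simp [G]
          · simp only [G, not_lt.mpr h.le, h.ne', if_false]
            constructor
            · intro h'
              exact absurd rfl h'.2
            · intro h'
              exact absurd (hab r h'.2.1 h) h'.2.2
        rw [this, Finset.card_erase_of_mem hmD, hD]
        rfl
      obtain ⟨g, hw, h0, h1, hs⟩ := ih (g₀ := G 1) (fun r => (hn r).trans (hG0 1 zero_le_one r))
        (hG1 1 le_rfl) (hGc 1) (by rw [hGS, one_mul]; exact hc) hcard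
      exact ⟨g, hw, fun r => (hG0 1 zero_le_one r).trans (h0 r), h1, hs⟩

/-- A window that lies above the tangent to the parabola `y = x² + e` at `x = u` and has its mean
to the left of `u` reaches down to the zone where that tangent is below the parabola `y = x²`.
Otherwise, cutting atoms off its left end until the mean is `u` would only increase the integral
of `(r - u)² - e`. -/
lemma WindowVarianceLE.exists_le_of_sum_neg {S : Finset ℝ} {w g : ℝ → ℝ} {e u : ℝ}
    (h : WindowVarianceLE S w e) (hg : IsWindow w g) (hneg : ∑ r ∈ S, g r * (r - u) < 0)
    (hpos : 0 < ∑ r ∈ S, g r * ((r - u) ^ 2 - e)) :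
    ∃ r, 0 < g r ∧ r ≤ u ∧ e ≤ (r - u) ^ 2 := by
  classical
  by_contra! hcon
  obtain ⟨k, hk, hk0, hk1, hks⟩ := hg.exists_between (S := S) (u := u)
    (g₀ := fun r => if u < r then g r else 0)
    (fun r => by split_ifs; exacts [hg.nonneg r, le_rfl])
    (fun r => by split_ifs; exacts [le_rfl, hg.nonneg r])
    (fun r r' hr hp => by
      have : u < r := by
        by_contra hu
        simp [hu] at hp
      simp [this.trans hr])
    hneg.le
    (Finset.sum_nonneg fun r _ => by
      split_ifs with hr
      · exact mul_nonneg (hg.nonneg r) (by linarith)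
      · simp)
  refine absurd (h k hk u hks) (not_le.mpr (hpos.trans_le (Finset.sum_le_sum fun r _ => ?_)))
  by_cases hr : u < r
  · have := hk0 r
    simp only [hr, if_true] at this
    rw [le_antisymm (hk1 r) this]
  · rcases (hg.nonneg r).eq_or_lt with h0 | h0
    · have := hk1 r
      rw [← h0] at this ⊢
      rw [le_antisymm this (hk.nonneg r)]
    · nlinarith [hk1 r, hcon r h0 (not_lt.mp hr)]

/-- If the part of `w` outside a window is far from `u`, and the window lies above the tangent to
the parabola `y = x² + e` at `x = u` and to the right of `u`, then so does `w`: while the window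
is extended to `w`, its mean cannot pass through `u`. -/
lemma WindowVarianceLE.sum_pos_of_window {S : Finset ℝ} {w g : ℝ → ℝ} {e u : ℝ}
    (h : WindowVarianceLE S w e) (hg : IsWindow w g)
    (hfar : ∀ r, g r ≠ w r → e ≤ (r - u) ^ 2) (hm : 0 < ∑ r ∈ S, g r * (r - u))
    (hpos : 0 < ∑ r ∈ S, g r * ((r - u) ^ 2 - e)) :
    0 < ∑ r ∈ S, w r * (r - u) ∧ 0 < ∑ r ∈ S, w r * ((r - u) ^ 2 - e) := by
  classical
  have hext : ∀ k : ℝ → ℝ, (∀ r, g r ≤ k r) → (∀ r, k r ≤ w r) →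
      0 < ∑ r ∈ S, k r * ((r - u) ^ 2 - e) := by
    intro k h0 h1
    refine hpos.trans_le (Finset.sum_le_sum fun r _ => ?_)
    by_cases hr : g r = w r
    · rw [le_antisymm (h0 r) ((h1 r).trans hr.ge)]
    · nlinarith [h0 r, hfar r hr]
  have hw0 : ∀ r, 0 ≤ w r := fun r => (hg.nonneg r).trans (hg.le r)
  refine ⟨?_, hext w hg.le fun _ => le_rfl⟩
  -- the window extended to the left as far as possible
  let L : ℝ → ℝ := fun r => if ∃ r', r < r' ∧ 0 < g r' then w r else g r
  have hgL : ∀ r, g r ≤ L r := by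
    intro r
    dsimp only [L]
    split_ifs
    exacts [hg.le r, le_rfl]
  have hLw : ∀ r, L r ≤ w r := by
    intro r
    dsimp only [L]
    split_ifs
    exacts [le_rfl, hg.le r]
  have hL : IsWindow w L := by
    refine ⟨fun r => (hg.nonneg r).trans (hgL r), hLw, fun r₁ r₂ r₃ _ h23 _ h3 => ?_⟩
    have : ∃ r', r₂ < r' ∧ 0 < g r' := by
      by_cases hr : ∃ r', r₃ < r' ∧ 0 < g r'
      · obtain ⟨r', h', hp⟩ := hr
        exact ⟨r', h23.trans h', hp⟩
      · simp only [L, hr, if_false] at h3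
        exact ⟨r₃, h23, h3⟩
    simp only [L, this, if_true]
  have hLpos : 0 < ∑ r ∈ S, L r * (r - u) := by
    by_contra hcon
    obtain ⟨k, hk, hk0, hk1, hks⟩ := hL.exists_between (S := S) (u := u) hg.nonneg hgL
      (fun r r' hr hp => by
        by_cases hr' : ∃ r'', r' < r'' ∧ 0 < g r''
        · obtain ⟨r'', h'', hp''⟩ := hr'
          have : ∃ r'', r' < r'' ∧ 0 < g r'' := ⟨r'', h'', hp''⟩
          simp only [L, this, if_true]
          exact hg.eq_of_between r r' r'' hr h'' hp hp''
        · simp only [L, hr', if_false]) (not_lt.mp hcon) hm.le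
    exact absurd (h k hk u hks) (not_le.mpr (hext k hk0 fun r => (hk1 r).trans (hLw r)))
  refine hLpos.trans_le (Finset.sum_le_sum fun r _ => ?_)
  by_cases hr : ∃ r', r < r' ∧ 0 < g r'
  · simp only [L, hr, if_true, le_refl]
  · -- everything that the window charges is at most `r`, and it charges a point above `u`
    obtain ⟨r', -, hr'⟩ := Finset.exists_lt_of_sum_lt
      (show ∑ r ∈ S, (0 : ℝ) < ∑ r ∈ S, g r * (r - u) by simpa using hm)
    have hgr' : 0 < g r' := lt_of_le_of_ne (hg.nonneg r') fun h0 => by simp [← h0] at hr'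
    have hur' : u < r' := by
      by_contra hu
      nlinarith
    have : r' ≤ r := by
      by_contra hlt
      exact hr ⟨r', not_le.mp hlt, hgr'⟩
    exact mul_le_mul_of_nonneg_right (hLw r) (by linarith)

/-- Windows of a sum of two weights split into windows of the summands. -/
lemma IsWindow.exists_add {w₁ w₂ g : ℝ → ℝ} (hw₁ : ∀ r, 0 ≤ w₁ r) (hw₂ : ∀ r, 0 ≤ w₂ r)
    (hg : IsWindow (fun r => w₁ r + w₂ r) g) :
    ∃ g₁ g₂, IsWindow w₁ g₁ ∧ IsWindow w₂ g₂ ∧ (∀ r, g r = g₁ r + g₂ r) ∧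
      ∀ r, g r = w₁ r + w₂ r → g₁ r = w₁ r ∧ g₂ r = w₂ r := by
  have hsum : ∀ r, 0 ≤ w₁ r + w₂ r := fun r => add_nonneg (hw₁ r) (hw₂ r)
  have hfull : ∀ v : ℝ → ℝ, (∀ r, 0 ≤ v r) → (∀ r, v r ≤ w₁ r + w₂ r) → ∀ r,
      g r = w₁ r + w₂ r → v r * (g r / (w₁ r + w₂ r)) = v r := by
    intro v hv hvw r hr
    rcases (hsum r).eq_or_lt with h0 | h0
    · have : v r = 0 := le_antisymm ((hvw r).trans h0.ge) (hv r)
      simp [this]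
    · rw [hr, div_self h0.ne', mul_one]
  have hwin : ∀ v : ℝ → ℝ, (∀ r, 0 ≤ v r) → (∀ r, v r ≤ w₁ r + w₂ r) →
      IsWindow v (fun r => v r * (g r / (w₁ r + w₂ r))) := by
    intro v hv hvw
    have hp : ∀ r, 0 < v r * (g r / (w₁ r + w₂ r)) → 0 < g r := by
      intro r hr
      refine lt_of_le_of_ne (hg.nonneg r) fun h0 => ?_
      simp [← h0] at hr
    refine ⟨fun r => mul_nonneg (hv r) (div_nonneg (hg.nonneg r) (hsum r)), fun r =>
      mul_le_of_le_one_right (hv r) (div_le_one_of_le₀ (hg.le r) (hsum r)),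
      fun r₁ r₂ r₃ h12 h23 h1 h3 => ?_⟩
    exact hfull v hv hvw r₂ (hg.eq_of_between r₁ r₂ r₃ h12 h23 (hp _ h1) (hp _ h3))
  have h1 : ∀ r, w₁ r ≤ w₁ r + w₂ r := fun r => by linarith [hw₂ r]
  have h2 : ∀ r, w₂ r ≤ w₁ r + w₂ r := fun r => by linarith [hw₁ r]
  refine ⟨_, _, hwin w₁ hw₁ h1, hwin w₂ hw₂ h2, fun r => ?_,
    fun r hr => ⟨hfull w₁ hw₁ h1 r hr, hfull w₂ hw₂ h2 r hr⟩⟩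
  rcases (hsum r).eq_or_lt with h0 | h0
  · have : g r = 0 := le_antisymm ((hg.le r).trans h0.ge) (hg.nonneg r)
    simp [this]
  · rw [← add_mul, mul_div_cancel₀ _ h0.ne']

/-! ### Sums of weights -/

/-- If two points below the parabola `y = x² + e` have a convex combination above it, then the
tangent to the parabola parallel to the segment that joins them passes below both of them and
touches the parabola between them. -/
lemma exists_tangent_below {m₁ m₂ x₁ x₂ y₁ y₂ e u : ℝ} (hm₁ : 0 < m₁) (hm₂ : 0 < m₂)
    (hx : x₁ < x₂) (h₁ : y₁ ≤ x₁ ^ 2 + e) (h₂ : y₂ ≤ x₂ ^ 2 + e)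
    (hu : m₁ * (x₁ - u) + m₂ * (x₂ - u) = 0)
    (hpos : 0 < m₁ * (y₁ - 2 * u * x₁ + u ^ 2 - e) + m₂ * (y₂ - 2 * u * x₂ + u ^ 2 - e)) :
    ∃ v, x₁ < v ∧ v < x₂ ∧ 0 < y₁ - 2 * v * x₁ + v ^ 2 - e ∧ 0 < y₂ - 2 * v * x₂ + v ^ 2 - e := by
  have hd : 0 < x₂ - x₁ := sub_pos.mpr hx
  set v := (y₂ - y₁) / (2 * (x₂ - x₁)) with hv
  have hv' : 2 * v * (x₂ - x₁) = y₂ - y₁ := by rw [hv]; field_simp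
  have hM : 0 < m₁ + m₂ := by linarith
  set κ := y₁ - 2 * v * x₁ + v ^ 2 - e with hκ
  have hκ₂ : y₂ - 2 * v * x₂ + v ^ 2 - e = κ := by rw [hκ]; linarith
  -- the convex combination lies on the chord
  have hκpos : (u - v) ^ 2 < κ := by
    have e1 : y₁ - 2 * u * x₁ + u ^ 2 - e = κ + 2 * (v - u) * (x₁ - u) - (v - u) ^ 2 := by
      rw [hκ]; ring
    have e2 : y₂ - 2 * u * x₂ + u ^ 2 - e = κ + 2 * (v - u) * (x₂ - u) - (v - u) ^ 2 := by
      rw [← hκ₂]; ring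
    rw [e1, e2] at hpos
    have : 0 < (m₁ + m₂) * (κ - (u - v) ^ 2) := by
      have h3 : 2 * (v - u) * (m₁ * (x₁ - u) + m₂ * (x₂ - u)) = 0 := by rw [hu, mul_zero]
      nlinarith
    linarith [pos_of_mul_pos_right this hM.le]
  have hb₁ : κ ≤ (x₁ - v) ^ 2 := by rw [hκ]; nlinarith
  have hb₂ : κ ≤ (x₂ - v) ^ 2 := by rw [← hκ₂]; nlinarith
  have hu₁ : x₁ ≤ u := by
    by_contra h
    nlinarith [mul_pos hm₁ (sub_pos.mpr (not_le.mp h)),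
      mul_pos hm₂ (sub_pos.mpr ((not_le.mp h).trans hx))]
  have hu₂ : u ≤ x₂ := by
    by_contra h
    nlinarith [mul_pos hm₂ (sub_pos.mpr (not_le.mp h)),
      mul_pos hm₁ (sub_pos.mpr (hx.trans (not_le.mp h)))]
  have hκ0 : 0 < κ := (sq_nonneg _).trans_lt hκpos
  refine ⟨v, ?_, ?_, hκ0, by rw [hκ₂]; exact hκ0⟩
  · by_contra h
    nlinarith
  · by_contra h
    nlinarith

lemma sum_sub_sq (S : Finset ℝ) (g : ℝ → ℝ) (u e : ℝ) :
    ∑ r ∈ S, g r * ((r - u) ^ 2 - e) =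
      ∑ r ∈ S, g r * r ^ 2 - 2 * u * ∑ r ∈ S, g r * r + (u ^ 2 - e) * ∑ r ∈ S, g r := by
  simp only [Finset.mul_sum, ← Finset.sum_add_distrib, ← Finset.sum_sub_distrib]
  exact Finset.sum_congr rfl fun r _ => by ring

lemma sum_mul_sub (S : Finset ℝ) (g : ℝ → ℝ) (u : ℝ) :
    ∑ r ∈ S, g r * (r - u) = ∑ r ∈ S, g r * r - u * ∑ r ∈ S, g r := by
  simp only [Finset.mul_sum, ← Finset.sum_sub_distrib]
  exact Finset.sum_congr rfl fun r _ => by ring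

/-- The case of `WindowVarianceLE.add` where the two parts of the window have their means in
increasing order. -/
lemma WindowVarianceLE.sum_add_le_of_lt {S : Finset ℝ} {w₁ w₂ g g₁ g₂ : ℝ → ℝ} {e c u : ℝ}
    (hw₁ : ∀ r, 0 ≤ w₁ r) (hw₂ : ∀ r, 0 ≤ w₂ r)
    (h₁ : WindowVarianceLE S w₁ e) (h₂ : WindowVarianceLE S w₂ e)
    (hc₁ : ∑ r ∈ S, w₁ r * ((r - c) ^ 2 - e) ≤ 0) (hc₂ : ∑ r ∈ S, w₂ r * ((r - c) ^ 2 - e) ≤ 0)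
    (hg : IsWindow (fun r => w₁ r + w₂ r) g) (hg₁ : IsWindow w₁ g₁) (hg₂ : IsWindow w₂ g₂)
    (hadd : ∀ r, g r = g₁ r + g₂ r)
    (hfull : ∀ r, g r = w₁ r + w₂ r → g₁ r = w₁ r ∧ g₂ r = w₂ r)
    (hm₁ : 0 < ∑ r ∈ S, g₁ r) (hm₂ : 0 < ∑ r ∈ S, g₂ r)
    (hlt : (∑ r ∈ S, g₁ r * r) / ∑ r ∈ S, g₁ r < (∑ r ∈ S, g₂ r * r) / ∑ r ∈ S, g₂ r)
    (hu : ∑ r ∈ S, g r * (r - u) = 0) : ∑ r ∈ S, g r * ((r - u) ^ 2 - e) ≤ 0 := by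
  by_contra! hpos
  have bary : ∀ k : ℝ → ℝ, 0 < ∑ r ∈ S, k r → ∃ x y, (∑ r ∈ S, k r * r) / (∑ r ∈ S, k r) = x ∧
      (∀ v, ∑ r ∈ S, k r * (r - v) = (∑ r ∈ S, k r) * (x - v)) ∧
      (∀ v, ∑ r ∈ S, k r * ((r - v) ^ 2 - e) =
        (∑ r ∈ S, k r) * (y - 2 * v * x + v ^ 2 - e)) := by
    intro k hk
    refine ⟨_, (∑ r ∈ S, k r * r ^ 2) / (∑ r ∈ S, k r), rfl, fun v => ?_, fun v => ?_⟩
    · rw [sum_mul_sub]; field_simp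
    · rw [sum_sub_sq]; field_simp; ring
  obtain ⟨x₁, y₁, hx₁, hl₁, hq₁⟩ := bary g₁ hm₁
  obtain ⟨x₂, y₂, hx₂, hl₂, hq₂⟩ := bary g₂ hm₂
  rw [hx₁, hx₂] at hlt
  have hv₁ : y₁ ≤ x₁ ^ 2 + e := by
    have := h₁ g₁ hg₁ x₁ (by rw [hl₁]; ring)
    rw [hq₁] at this
    nlinarith [nonpos_of_mul_nonpos_right this hm₁]
  have hv₂ : y₂ ≤ x₂ ^ 2 + e := by
    have := h₂ g₂ hg₂ x₂ (by rw [hl₂]; ring)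
    rw [hq₂] at this
    nlinarith [nonpos_of_mul_nonpos_right this hm₂]
  simp only [hadd, add_mul, Finset.sum_add_distrib, hl₁, hl₂, hq₁, hq₂] at hu hpos
  obtain ⟨v, hxv, hvx, ht₁, ht₂⟩ := exists_tangent_below hm₁ hm₂ hlt hv₁ hv₂ hu hpos
  have hl₁' : ∑ r ∈ S, g₁ r * (r - v) < 0 := by rw [hl₁]; nlinarith
  have hl₂' : 0 < ∑ r ∈ S, g₂ r * (r - v) := by rw [hl₂]; nlinarith
  have hq₁' : 0 < ∑ r ∈ S, g₁ r * ((r - v) ^ 2 - e) := by rw [hq₁]; exact mul_pos hm₁ ht₁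
  have hq₂' : 0 < ∑ r ∈ S, g₂ r * ((r - v) ^ 2 - e) := by rw [hq₂]; exact mul_pos hm₂ ht₂
  have neg_l : ∀ k : ℝ → ℝ, ∑ r ∈ S, k (- -r) * (-r - -v) = -∑ r ∈ S, k r * (r - v) := by
    intro k
    rw [← Finset.sum_neg_distrib]
    exact Finset.sum_congr rfl fun r _ => by rw [neg_neg]; ring
  have neg_q : ∀ k : ℝ → ℝ, ∑ r ∈ S, k (- -r) * ((-r - -v) ^ 2 - e) =
      ∑ r ∈ S, k r * ((r - v) ^ 2 - e) := by
    intro k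
    exact Finset.sum_congr rfl fun r _ => by rw [neg_neg]; ring
  -- the window reaches down to `v - √e` and up to `v + √e`
  obtain ⟨a, hga, hav, hae⟩ := h₁.exists_le_of_sum_neg hg₁ hl₁' hq₁'
  obtain ⟨b, hgb, hbv, hbe⟩ := h₂.comp_neg.exists_le_of_sum_neg (u := -v) hg₂.comp_neg
    (by rw [sum_map_neg, neg_l]; linarith) (by rw [sum_map_neg, neg_q]; exact hq₂')
  have hga' : 0 < g a := by rw [hadd]; linarith [hg₂.nonneg a]
  have hgb' : 0 < g (-b) := by rw [hadd]; linarith [hg₁.nonneg (-b)]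
  have hfar : ∀ r, g r ≠ w₁ r + w₂ r → e ≤ (r - v) ^ 2 := by
    intro r hr
    rcases le_or_gt r a with h | h
    · nlinarith
    · rcases le_or_gt (-b) r with h' | h'
      · nlinarith
      · exact absurd (hg.eq_of_between a r (-b) h h' hga' hgb') hr
  have hfar₁ : ∀ r, g₁ r ≠ w₁ r → e ≤ (r - v) ^ 2 := fun r hr =>
    hfar r fun h => hr (hfull r h).1
  have hfar₂ : ∀ r, g₂ r ≠ w₂ r → e ≤ (r - v) ^ 2 := fun r hr =>
    hfar r fun h => hr (hfull r h).2
  obtain ⟨hL₂, hQ₂⟩ := h₂.sum_pos_of_window hg₂ hfar₂ hl₂' hq₂'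
  obtain ⟨hL₁, hQ₁⟩ := h₁.comp_neg.sum_pos_of_window (u := -v) hg₁.comp_neg
    (fun r hr => by
      have := hfar₁ (-r) hr
      nlinarith)
    (by rw [sum_map_neg, neg_l]; linarith) (by rw [sum_map_neg, neg_q]; exact hq₁')
  rw [sum_map_neg, neg_l] at hL₁
  rw [sum_map_neg, neg_q] at hQ₁
  -- two points above the tangent at `v` and on different sides of `v` cannot both be below the
  -- tangent at `c`
  have hshift : ∀ k : ℝ → ℝ, ∑ r ∈ S, k r * ((r - v) ^ 2 - e) - ∑ r ∈ S, k r * ((r - c) ^ 2 - e) =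
      (c - v) * (2 * ∑ r ∈ S, k r * (r - v) - (c - v) * ∑ r ∈ S, k r) := by
    intro k
    rw [sum_sub_sq, sum_sub_sq, sum_mul_sub]
    ring
  have hd₁ := hshift w₁
  have hd₂ := hshift w₂
  have hW₁ : 0 ≤ ∑ r ∈ S, w₁ r := Finset.sum_nonneg fun r _ => hw₁ r
  have hW₂ : 0 ≤ ∑ r ∈ S, w₂ r := Finset.sum_nonneg fun r _ => hw₂ r
  have hp₁ : 0 < (c - v) * (2 * ∑ r ∈ S, w₁ r * (r - v) - (c - v) * ∑ r ∈ S, w₁ r) := by linarith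
  have hp₂ : 0 < (c - v) * (2 * ∑ r ∈ S, w₂ r * (r - v) - (c - v) * ∑ r ∈ S, w₂ r) := by linarith
  rcases le_total c v with hcv | hcv
  · refine absurd hp₂ (not_lt.mpr (mul_nonpos_of_nonpos_of_nonneg (by linarith) ?_))
    have := mul_nonneg (sub_nonneg.mpr hcv) hW₂
    linarith
  · refine absurd hp₁ (not_lt.mpr (mul_nonpos_of_nonneg_of_nonpos (by linarith) ?_))
    have := mul_nonneg (sub_nonneg.mpr hcv) hW₁
    linarith

/-- The mixing step. If the barycentres `(∑ w r, ∑ w r²)` of both weights, normalized, lie below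
the tangent to the parabola `y = x² + e` at the point `x = c`, then the variance bound for the
windows of the two weights is inherited by their sum. -/
lemma WindowVarianceLE.add {S : Finset ℝ} {w₁ w₂ : ℝ → ℝ} {e c : ℝ}
    (hw₁ : ∀ r, 0 ≤ w₁ r) (hw₂ : ∀ r, 0 ≤ w₂ r)
    (h₁ : WindowVarianceLE S w₁ e) (h₂ : WindowVarianceLE S w₂ e)
    (hc₁ : ∑ r ∈ S, w₁ r * ((r - c) ^ 2 - e) ≤ 0) (hc₂ : ∑ r ∈ S, w₂ r * ((r - c) ^ 2 - e) ≤ 0) :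
    WindowVarianceLE S (fun r => w₁ r + w₂ r) e := by
  intro g hg u hu
  obtain ⟨g₁, g₂, hg₁, hg₂, hadd, hfull⟩ := hg.exists_add hw₁ hw₂
  have hz : ∀ k k' : ℝ → ℝ, (∀ r, 0 ≤ k r) → ∑ r ∈ S, k r = 0 → ∀ F : ℝ → ℝ,
      ∑ r ∈ S, (k r + k' r) * F r = ∑ r ∈ S, k' r * F r := by
    intro k k' hk h0 F
    refine Finset.sum_congr rfl fun r hr => ?_
    rw [(Finset.sum_eq_zero_iff_of_nonneg fun r _ => hk r).mp h0 r hr, zero_add]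
  rcases (Finset.sum_nonneg fun r (_ : r ∈ S) => hg₁.nonneg r).eq_or_lt with hm₁ | hm₁
  · simp only [hadd] at hu ⊢
    rw [hz g₁ g₂ hg₁.nonneg hm₁.symm] at hu ⊢
    exact h₂ g₂ hg₂ u hu
  rcases (Finset.sum_nonneg fun r (_ : r ∈ S) => hg₂.nonneg r).eq_or_lt with hm₂ | hm₂
  · simp only [hadd, add_comm (g₁ _)] at hu ⊢
    rw [hz g₂ g₁ hg₂.nonneg hm₂.symm] at hu ⊢
    exact h₁ g₁ hg₁ u hu
  rcases lt_trichotomy ((∑ r ∈ S, g₁ r * r) / ∑ r ∈ S, g₁ r)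
    ((∑ r ∈ S, g₂ r * r) / ∑ r ∈ S, g₂ r) with hlt | heq | hlt
  · exact sum_add_le_of_lt hw₁ hw₂ h₁ h₂ hc₁ hc₂ hg hg₁ hg₂ hadd hfull hm₁ hm₂ hlt hu
  · -- both parts have mean `u`
    simp only [hadd, add_mul, Finset.sum_add_distrib] at hu ⊢
    rw [div_eq_div_iff hm₁.ne' hm₂.ne'] at heq
    rw [sum_mul_sub, sum_mul_sub] at hu
    have hu₁ : ∑ r ∈ S, g₁ r * (r - u) = 0 := by
      rw [sum_mul_sub]
      have : (∑ r ∈ S, g₁ r + ∑ r ∈ S, g₂ r) *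
          (∑ r ∈ S, g₁ r * r - u * ∑ r ∈ S, g₁ r) = 0 := by
        linear_combination heq + (∑ r ∈ S, g₁ r) * hu
      exact (mul_eq_zero.mp this).resolve_left (by linarith)
    have hu₂ : ∑ r ∈ S, g₂ r * (r - u) = 0 := by
      rw [sum_mul_sub] at hu₁ ⊢
      linarith
    linarith [h₁ g₁ hg₁ u hu₁, h₂ g₂ hg₂ u hu₂]
  · exact sum_add_le_of_lt hw₂ hw₁ h₂ h₁ hc₂ hc₁ (by simpa only [add_comm] using hg) hg₂ hg₁
      (fun r => by rw [hadd, add_comm])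
      (fun r hr => (hfull r (by rw [hr, add_comm])).symm) hm₂ hm₁ hlt hu

lemma windowVarianceLE_zero (S : Finset ℝ) (e : ℝ) : WindowVarianceLE S (fun _ => 0) e := by
  intro g hg u _
  have : ∀ r, g r = 0 := fun r => le_antisymm (hg.le r) (hg.nonneg r)
  simp [this]

lemma WindowVarianceLE.sum {ι : Type*} {S : Finset ℝ} {T : Finset ι} {w : ι → ℝ → ℝ} {e c : ℝ}
    (hw : ∀ i r, 0 ≤ w i r) (h : ∀ i ∈ T, WindowVarianceLE S (w i) e)
    (hc : ∀ i ∈ T, ∑ r ∈ S, w i r * ((r - c) ^ 2 - e) ≤ 0) :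
    WindowVarianceLE S (fun r => ∑ i ∈ T, w i r) e := by
  classical
  suffices WindowVarianceLE S (fun r => ∑ i ∈ T, w i r) e ∧
      ∑ r ∈ S, (∑ i ∈ T, w i r) * ((r - c) ^ 2 - e) ≤ 0 from this.1
  induction T using Finset.induction_on with
  | empty => simpa using windowVarianceLE_zero S e
  | insert i T hi ih =>
    obtain ⟨h1, h2⟩ := ih (fun j hj => h j (Finset.mem_insert_of_mem hj))
      (fun j hj => hc j (Finset.mem_insert_of_mem hj))
    simp only [Finset.sum_insert hi]
    have hi' := hc i (Finset.mem_insert_self i T)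
    refine ⟨(h i (Finset.mem_insert_self i T)).add (hw i)
      (fun r => Finset.sum_nonneg fun j _ => hw j r) h1 hi' h2, ?_⟩
    simp only [add_mul, Finset.sum_add_distrib]
    linarith

/-! ### The laws of martingales on finite algebras -/

/-- A function measurable with respect to a finite σ-algebra has finite range. -/
lemma finite_range_of_finite_measurableSet {X : Type*} {m : MeasurableSpace X}
    (hm : {s : Set X | MeasurableSet[m] s}.Finite) {φ : X → ℝ} (hφ : Measurable[m] φ) :
    (Set.range φ).Finite := by
  refine Set.Finite.of_finite_image (f := fun v => φ ⁻¹' {v}) (hm.subset ?_) ?_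
  · rintro _ ⟨v, -, rfl⟩
    exact hφ (measurableSet_singleton v)
  · rintro _ ⟨ω, rfl⟩ v - h
    have : ω ∈ φ ⁻¹' {v} := by
      rw [← show φ ⁻¹' {φ ω} = φ ⁻¹' {v} from h]
      simp
    simpa using this

section FiniteRange

variable {X : Type*} [MeasurableSpace X] {P : Measure X} [IsFiniteMeasure P]

/-- Integration of a function of `φ` when `φ` takes finitely many values. -/
lemma setIntegral_comp_eq_sum {φ : X → ℝ} (hφ : Measurable φ) {S : Finset ℝ} {B : Set X}
    (hB : MeasurableSet B) (hS : ∀ᵐ ω ∂P, ω ∈ B → φ ω ∈ S) (F : ℝ → ℝ) :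
    ∫ ω in B, F (φ ω) ∂P = ∑ r ∈ S, P.real (B ∩ φ ⁻¹' {r}) * F r := by
  classical
  have h1 : ∀ᵐ ω ∂(P.restrict B), F (φ ω) =
      ∑ r ∈ S, (φ ⁻¹' {r}).indicator (fun _ => F r) ω := by
    filter_upwards [(ae_restrict_iff' hB).mpr hS] with ω hω
    simp only [Set.indicator_apply, Set.mem_preimage, Set.mem_singleton_iff]
    rw [Finset.sum_ite_eq, if_pos hω]
  have hm : ∀ r, MeasurableSet (φ ⁻¹' {r}) := fun r => hφ (measurableSet_singleton r)
  rw [integral_congr_ae h1, integral_finsetSum _ fun r _ => (integrable_const _).indicator (hm r)]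
  refine Finset.sum_congr rfl fun r _ => ?_
  rw [integral_indicator_const _ (hm r), measureReal_restrict_apply (hm r), smul_eq_mul,
    Set.inter_comm]

lemma sum_measureReal_inter_preimage {φ : X → ℝ} (hφ : Measurable φ) {S : Finset ℝ} {B : Set X}
    (hB : MeasurableSet B) (hS : ∀ᵐ ω ∂P, ω ∈ B → φ ω ∈ S) :
    ∑ r ∈ S, P.real (B ∩ φ ⁻¹' {r}) = P.real B := by
  simpa using (setIntegral_comp_eq_sum hφ hB hS fun _ => 1).symm

end FiniteRange

/-- The law of a martingale whose terms take finitely many values, restricted to an event from the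
past on which the present value is fixed: if the remaining part of the square function is at most
`√e`, then all its windows have variance at most `e`. At each step the events of the next generation,
where the increment is `v - x`, have the smaller bound `e - (v - x)²`; this is exactly what puts
their barycentres below the tangent to the parabola `y = x² + e` at the present value `x`. -/
theorem windowVarianceLE_of_martingale {X : Type*} [m : MeasurableSpace X] {P : Measure X}
    [IsProbabilityMeasure P] {ℱ : Filtration ℕ m} {φ : ℕ → X → ℝ} (hφ : Martingale φ ℱ P)
    (hfin : ∀ n, (Set.range (φ n)).Finite) (j : ℕ) {n N : ℕ} (hn : n + j = N) {A : Set X}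
    (hA : MeasurableSet[ℱ n] A) {x e : ℝ} (hx : ∀ ω ∈ A, φ n ω = x)
    (he : ∀ᵐ ω ∂P, ω ∈ A → ∑ k ∈ Finset.Ico n N, (φ (k + 1) ω - φ k ω) ^ 2 ≤ e) :
    WindowVarianceLE (hfin N).toFinset (fun r => P.real (A ∩ φ N ⁻¹' {r})) e := by
  have hmeas : ∀ n, Measurable[ℱ n] (φ n) := fun n => (hφ.1 n).measurable
  have hmeas' : ∀ n, Measurable (φ n) := fun n => (hmeas n).mono (ℱ.le n) le_rfl
  induction j generalizing n A x e with
  | zero =>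
    obtain rfl : n = N := by simpa using hn
    intro g hg u hu
    refine Finset.sum_nonpos fun r hr => ?_
    have hz : ∀ r, r ≠ x → g r = 0 := by
      intro r hr
      refine le_antisymm ((hg.le r).trans ?_) (hg.nonneg r)
      have : A ∩ φ n ⁻¹' {r} = ∅ := by
        ext ω
        simp only [Set.mem_inter_iff, Set.mem_preimage, Set.mem_singleton_iff,
          Set.mem_empty_iff_false, iff_false, not_and]
        intro hω h
        exact hr (h ▸ hx ω hω)
      simp [this]
    by_cases hrx : r = x
    · subst hrx
      rw [Finset.sum_eq_single r (fun b _ hb => by rw [hz b hb, zero_mul])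
        (fun h => absurd hr h)] at hu
      rcases mul_eq_zero.mp hu with h0 | h0
      · simp [h0]
      · have : 0 ≤ e ∨ g r = 0 := by
          by_cases hPA : P A = 0
          · right
            refine le_antisymm ((hg.le r).trans ?_) (hg.nonneg r)
            rw [measureReal_def, measure_mono_null Set.inter_subset_left hPA]
            simp
          · left
            by_contra hneg
            refine hPA ?_
            have : ∀ᵐ ω ∂P, ω ∉ A := by
              filter_upwards [he] with ω hω hA
              exact hneg (by simpa using hω hA)
            simpa [ae_iff] using this
        rcases this with h1 | h1
        · rw [h0]
          exact mul_nonpos_of_nonneg_of_nonpos (hg.nonneg r) (by linarith)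
        · simp [h1]
    · simp [hz r hrx]
  | succ j ih =>
    have hlt : n < N := by omega
    set S := (hfin N).toFinset
    have hmem : ∀ ω, φ N ω ∈ S := fun ω => by simp [S]
    let T := (hfin (n + 1)).toFinset
    let B : ℝ → Set X := fun v => A ∩ φ (n + 1) ⁻¹' {v}
    have hB : ∀ v, MeasurableSet[ℱ (n + 1)] (B v) := fun v =>
      ((ℱ.mono n.le_succ) A hA).inter (hmeas (n + 1) (measurableSet_singleton v))
    have hB' : ∀ v, MeasurableSet (B v) := fun v => ℱ.le _ _ (hB v)
    have hsplit : (fun r => P.real (A ∩ φ N ⁻¹' {r})) =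
        fun r => ∑ v ∈ T, P.real (B v ∩ φ N ⁻¹' {r}) := by
      funext r
      rw [← sum_measureReal_inter_preimage (hmeas' (n + 1)) (S := T)
        ((ℱ.le n A hA).inter (hmeas' N (measurableSet_singleton r)))
        (ae_of_all _ fun ω _ => by simp [T])]
      refine Finset.sum_congr rfl fun v _ => ?_
      rw [Set.inter_right_comm]
    have hstep : ∀ v, WindowVarianceLE S (fun r => P.real (B v ∩ φ N ⁻¹' {r}))
        (e - (v - x) ^ 2) := by
      intro v
      refine ih (by omega) (hB v) (fun ω hω => hω.2) ?_
      filter_upwards [he] with ω hω hωB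
      have h := hω hωB.1
      rw [Finset.sum_eq_sum_Ico_succ_bot hlt, hx ω hωB.1,
        show φ (n + 1) ω = v from hωB.2] at h
      linarith
    rw [hsplit]
    refine WindowVarianceLE.sum (c := x) (fun v r => measureReal_nonneg)
      (fun v _ => (hstep v).mono (by nlinarith [sq_nonneg (v - x)])) fun v _ => ?_
    have hmean : ∑ r ∈ S, P.real (B v ∩ φ N ⁻¹' {r}) * (r - v) = 0 := by
      rw [← setIntegral_comp_eq_sum (hmeas' N) (hB' v) (ae_of_all _ fun ω _ => hmem ω)
        (fun r => r - v), integral_sub (hφ.integrable N).integrableOn (integrable_const _),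
        ← hφ.setIntegral_eq hlt (hB v), sub_eq_zero]
      exact setIntegral_congr_fun (hB' v) fun ω hω => hω.2
    have hvar := hstep v _ (IsWindow.refl fun r => measureReal_nonneg) v hmean
    have : ∑ r ∈ S, P.real (B v ∩ φ N ⁻¹' {r}) * ((r - x) ^ 2 - e) =
        ∑ r ∈ S, P.real (B v ∩ φ N ⁻¹' {r}) * ((r - v) ^ 2 - (e - (v - x) ^ 2)) +
        2 * (v - x) * ∑ r ∈ S, P.real (B v ∩ φ N ⁻¹' {r}) * (r - v) := by
      rw [Finset.mul_sum, ← Finset.sum_add_distrib]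
      exact Finset.sum_congr rfl fun r _ => by ring
    rw [this, hmean, mul_zero, add_zero]
    exact hvar

/-! ### Quantile functions and the variance on intervals -/

open ProbabilityTheory

open Classical in
/-- The quantile function of a measure on the line, extended by `0` from `(0,1)` to the line. -/
noncomputable def quantile (μ : Measure ℝ) (t : ℝ) : ℝ :=
  if t ∈ Set.Ioo (0 : ℝ) 1 then sInf {x | t ≤ cdf μ x} else 0

lemma quantile_le_iff {μ : Measure ℝ} {t : ℝ} (ht : t ∈ Set.Ioo (0 : ℝ) 1) {x : ℝ} :
    quantile μ t ≤ x ↔ t ≤ cdf μ x := by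
  rw [quantile, if_pos ht]
  have hne : {x | t ≤ cdf μ x}.Nonempty := by
    obtain ⟨x, hx⟩ := ((tendsto_cdf_atTop μ).eventually (lt_mem_nhds ht.2)).exists
    exact ⟨x, hx.le⟩
  have hbdd : BddBelow {x | t ≤ cdf μ x} := by
    obtain ⟨y, hy⟩ := ((tendsto_cdf_atBot μ).eventually (gt_mem_nhds ht.1)).exists
    refine ⟨y, fun x hx => ?_⟩
    by_contra h
    exact absurd (monotone_cdf μ (not_le.mp h).le) (not_le.mpr (hy.trans_le hx))
  refine ⟨fun h => ?_, fun h => csInf_le hbdd h⟩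
  -- right continuity of the distribution function
  have hgt : ∀ y, x < y → t ≤ cdf μ y := by
    intro y hy
    obtain ⟨z, hz, hzy⟩ := (csInf_lt_iff hbdd hne).mp (h.trans_lt hy)
    exact hz.trans (monotone_cdf μ hzy.le)
  have hlim : Tendsto (cdf μ) (𝓝[>] x) (𝓝 (cdf μ x)) :=
    ((cdf μ).right_continuous x).tendsto.mono_left (nhdsWithin_mono _ Set.Ioi_subset_Ici_self)
  exact ge_of_tendsto hlim (eventually_mem_nhdsWithin.mono fun y hy => hgt y hy)

lemma measurable_quantile (μ : Measure ℝ) : Measurable (quantile μ) := by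
  refine measurable_of_Iic fun x => ?_
  have : quantile μ ⁻¹' Set.Iic x = (Set.Ioo 0 1 ∩ Set.Iic (cdf μ x)) ∪
      ((Set.Ioo 0 1)ᶜ ∩ {_t | 0 ≤ x}) := by
    ext t
    by_cases ht : t ∈ Set.Ioo (0 : ℝ) 1
    · simp only [Set.mem_preimage, Set.mem_Iic, quantile_le_iff ht, Set.mem_union,
        Set.mem_inter_iff, Set.mem_compl_iff, ht, true_and, not_true, false_and, or_false]
    · simp only [Set.mem_preimage, Set.mem_Iic, quantile, ht, if_false, Set.mem_union,
        Set.mem_inter_iff, Set.mem_compl_iff, false_and, not_false_iff, true_and, false_or,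
        Set.mem_ofPred_eq]
  rw [this]
  exact (measurableSet_Ioo.inter measurableSet_Iic).union
    (measurableSet_Ioo.compl.inter (MeasurableSet.const _))

lemma monotoneOn_quantile (μ : Measure ℝ) : MonotoneOn (quantile μ) (Set.Ioo 0 1) :=
  fun _ hs _ ht hst => (quantile_le_iff hs).mpr (hst.trans ((quantile_le_iff ht).mp le_rfl))

lemma map_quantile (μ : Measure ℝ) [IsProbabilityMeasure μ] :
    (volume.restrict (Set.Ioo 0 1)).map (quantile μ) = μ := by
  refine Measure.ext_of_Iic _ _ fun x => ?_
  rw [Measure.map_apply (measurable_quantile μ) measurableSet_Iic,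
    Measure.restrict_apply (measurable_quantile μ measurableSet_Iic), ← ofReal_cdf]
  have h1 : quantile μ ⁻¹' Set.Iic x ∩ Set.Ioo 0 1 = Set.Iic (cdf μ x) ∩ Set.Ioo 0 1 := by
    ext t
    refine and_congr_left fun ht => quantile_le_iff ht
  rw [h1, measure_congr ((ae_eq_refl _).inter Ioo_ae_eq_Ioc)]
  have h2 : Set.Iic (cdf μ x) ∩ Set.Ioc 0 1 = Set.Ioc 0 (cdf μ x) := by
    ext t
    simp only [Set.mem_inter_iff, Set.mem_Iic, Set.mem_Ioc]
    exact ⟨fun h => ⟨h.2.1, h.1⟩, fun h => ⟨h.2, h.1, h.2.trans (cdf_le_one μ x)⟩⟩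
  rw [h2, Real.volume_Ioc, sub_zero]

lemma restrict_Ioo_restrict_Icc {a b : ℝ} (ha : 0 ≤ a) (hb : b ≤ 1) :
    (volume.restrict (Set.Ioo (0 : ℝ) 1)).restrict (Set.Icc a b) =
      volume.restrict (Set.Icc a b) := by
  rw [Measure.restrict_congr_set (Ioo_ae_eq_Icc (a := (0 : ℝ)) (b := 1)),
    Measure.restrict_restrict measurableSet_Icc,
    Set.inter_eq_left.mpr (Set.Icc_subset_Icc ha hb)]

/-- A subinterval of `[0,1]` cuts a window out of the law of a monotone function `ψ`; hence a
variance bound for the windows of the law bounds the variance of `ψ` on all subintervals. -/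
lemma WindowVarianceLE.lintegral_sub_average_sq_le {X : Type*} [MeasurableSpace X] {P : Measure X}
    {φ : X → ℝ} (hφ : Measurable φ) {S : Finset ℝ} (hS : ∀ ω, φ ω ∈ S) {e : ℝ}
    (hw : WindowVarianceLE S (fun r => P.real (φ ⁻¹' {r})) e) {ψ : ℝ → ℝ} (hψ : Measurable ψ)
    (hmono : MonotoneOn ψ (Set.Ioo 0 1))
    (hlaw : (volume.restrict (Set.Ioo 0 1)).map ψ = P.map φ) {a b : ℝ} (ha : 0 ≤ a) (hab : a < b)
    (hb : b ≤ 1) :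
    ∫⁻ t in Set.Icc a b, ENNReal.ofReal ((ψ t - ⨍ u in Set.Icc a b, ψ u) ^ 2) ≤
      ENNReal.ofReal (e * (b - a)) := by
  set ν : Measure ℝ := volume.restrict (Set.Ioo 0 1) with hν
  set J := Set.Icc a b
  have hrestr : ν.restrict J = volume.restrict J := restrict_Ioo_restrict_Icc ha hb
  have hmass : ∀ r, P.real (φ ⁻¹' {r}) = ν.real (ψ ⁻¹' {r}) := by
    intro r
    rw [measureReal_def, measureReal_def, ← Measure.map_apply hφ (measurableSet_singleton r),
      ← hlaw, Measure.map_apply hψ (measurableSet_singleton r)]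
  have hψS : ∀ᵐ t ∂ν, ψ t ∈ S := by
    have : ∀ᵐ x ∂(P.map φ), x ∈ S :=
      (ae_map_iff hφ.aemeasurable S.measurableSet).mpr (ae_of_all _ hS)
    rw [← hlaw] at this
    exact (ae_map_iff hψ.aemeasurable S.measurableSet).mp this
  have hψJ : ∀ᵐ t ∂(volume.restrict J), ψ t ∈ S := by
    rw [← hrestr]
    exact ae_restrict_of_ae hψS
  have hint : ∀ F : ℝ → ℝ, Measurable F → IntegrableOn (fun t => F (ψ t)) J := by
    intro F hF
    obtain ⟨C, hC⟩ := (S.image fun r => |F r|).bddAbove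
    refine Integrable.of_bound (hF.comp hψ).aestronglyMeasurable C ?_
    filter_upwards [hψJ] with t ht
    exact hC (Finset.mem_coe.mpr (Finset.mem_image_of_mem _ ht))
  have hsum : ∀ F : ℝ → ℝ, ∑ r ∈ S, ν.real (J ∩ ψ ⁻¹' {r}) * F r = ∫ t in J, F (ψ t) := by
    intro F
    rw [← hrestr]
    exact (setIntegral_comp_eq_sum hψ measurableSet_Icc (hψS.mono fun _ h _ => h) F).symm
  have hwin : IsWindow (fun r => P.real (φ ⁻¹' {r})) (fun r => ν.real (J ∩ ψ ⁻¹' {r})) := by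
    refine ⟨fun r => measureReal_nonneg, fun r => ?_, fun r₁ r₂ r₃ h12 h23 h1 h3 => ?_⟩
    · rw [hmass]
      exact measureReal_mono Set.inter_subset_right
    · rw [hmass]
      have hex : ∀ r, 0 < ν.real (J ∩ ψ ⁻¹' {r}) → ∃ t ∈ J, t ∈ Set.Ioo (0 : ℝ) 1 ∧ ψ t = r := by
        intro r hr
        by_contra hcon
        push Not at hcon
        have hemp : (J ∩ ψ ⁻¹' {r}) ∩ Set.Ioo 0 1 = ∅ := by
          ext t
          simp only [Set.mem_inter_iff, Set.mem_preimage, Set.mem_singleton_iff,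
            Set.mem_empty_iff_false, iff_false]
          rintro ⟨⟨h1, h2⟩, h3⟩
          exact hcon t h1 h3 h2
        rw [measureReal_def, hν, Measure.restrict_apply
          (measurableSet_Icc.inter (hψ (measurableSet_singleton r))), hemp] at hr
        simp at hr
      obtain ⟨t₁, ht₁, hi₁, rfl⟩ := hex r₁ h1
      obtain ⟨t₃, ht₃, hi₃, rfl⟩ := hex r₃ h3
      refine measureReal_congr ?_
      filter_upwards [ae_restrict_mem measurableSet_Ioo] with t ht
      refine propext ⟨fun h => h.2, fun h => ⟨⟨ht₁.1.trans ?_, le_trans ?_ ht₃.2⟩, h⟩⟩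
      · by_contra hlt
        have := hmono ht hi₁ (not_le.mp hlt).le
        rw [show ψ t = r₂ from h] at this
        linarith
      · by_contra hlt
        have := hmono hi₃ ht (not_le.mp hlt).le
        rw [show ψ t = r₂ from h] at this
        linarith
  have hvol : volume.real J = b - a := by
    rw [Real.volume_real_Icc, max_eq_left (by linarith)]
  have hconst : ∀ c : ℝ, IntegrableOn (fun _ : ℝ => c) J := fun c =>
    hint (fun _ => c) measurable_const
  set c := ⨍ u in J, ψ u with hc
  have hc' : ∫ t in J, ψ t = c * (b - a) := by
    rw [hc, setAverage_eq, hvol, smul_eq_mul]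
    field_simp [(sub_pos.mpr hab).ne']
  have hle := hw _ hwin c (by
    rw [hsum fun r => r - c, integral_sub (f := ψ) (hint id measurable_id) (hconst c),
      setIntegral_const, hvol, smul_eq_mul, hc']
    ring)
  rw [hsum fun r => (r - c) ^ 2 - e, integral_sub (f := fun t => (ψ t - c) ^ 2)
    (hint (fun r => (r - c) ^ 2) (by fun_prop)) (hconst e),
    setIntegral_const, hvol, smul_eq_mul] at hle
  rw [← ofReal_integral_eq_lintegral_ofReal (hint (fun r => (r - c) ^ 2) (by fun_prop))
    (ae_of_all _ fun t => sq_nonneg _)]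
  exact ENNReal.ofReal_le_ofReal (by linarith)

/-- To bound the norm in `BMO([0,1])` one may subtract arbitrary constants instead of the means. -/
lemma bmoNorm_le {ψ : ℝ → ℝ} (hψ : IntegrableOn ψ (Set.Icc 0 1)) {ε : ℝ} (hε : 0 ≤ ε)
    (h : ∀ a b, 0 ≤ a → a < b → b ≤ 1 → ∃ c, ∫⁻ t in Set.Icc a b, ENNReal.ofReal ((ψ t - c) ^ 2) ≤
      ENNReal.ofReal (ε ^ 2 * (b - a))) :
    bmoNorm ψ ≤ ENNReal.ofReal ε := by
  have hroot : ENNReal.ofReal ε = (ENNReal.ofReal (ε ^ 2)) ^ (1 / 2 : ℝ) := by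
    rw [ENNReal.ofReal_rpow_of_nonneg (sq_nonneg ε) (by norm_num), ← Real.sqrt_eq_rpow,
      Real.sqrt_sq hε]
  rw [bmoNorm, hroot]
  refine ENNReal.rpow_le_rpow ?_ (by norm_num)
  refine iSup_le fun a => iSup_le fun b => iSup_le fun ha => iSup_le fun hab => iSup_le fun hb => ?_
  obtain ⟨c, hc⟩ := h a b ha hab hb
  have hba : 0 < b - a := sub_pos.mpr hab
  set J := Set.Icc a b
  have hvol : volume.real J = b - a := by
    rw [Real.volume_real_Icc, max_eq_left (by linarith)]
  have hψJ : IntegrableOn ψ J := hψ.mono_set (Set.Icc_subset_Icc ha hb)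
  have hconst : ∀ c : ℝ, IntegrableOn (fun _ : ℝ => c) J := fun c =>
    integrableOn_const measure_Icc_lt_top.ne
  set μ := ⨍ u in J, ψ u with hμ
  have hμ' : ∫ t in J, ψ t = μ * (b - a) := by
    rw [hμ, setAverage_eq, hvol, smul_eq_mul]
    field_simp
  have hsq : IntegrableOn (fun t => (ψ t - c) ^ 2) J := by
    refine ⟨((hψJ.aestronglyMeasurable.sub aestronglyMeasurable_const).pow 2), ?_⟩
    rw [hasFiniteIntegral_iff_ofReal (ae_of_all _ fun t => sq_nonneg _)]
    exact hc.trans_lt ENNReal.ofReal_lt_top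
  have hlin : IntegrableOn (fun t => 2 * (μ - c) * (ψ t - μ)) J :=
    (hψJ.sub (hconst μ)).const_mul _
  have hdiff : IntegrableOn (fun t => (ψ t - c) ^ 2 - 2 * (μ - c) * (ψ t - μ)) J :=
    hsq.sub hlin
  have hexp : ∀ t, (ψ t - μ) ^ 2 = (ψ t - c) ^ 2 - 2 * (μ - c) * (ψ t - μ) - (μ - c) ^ 2 :=
    fun t => by ring
  have hsqμ : IntegrableOn (fun t => (ψ t - μ) ^ 2) J := by
    simp only [hexp]
    exact hdiff.sub (hconst _)
  have hval : ∫ t in J, (ψ t - μ) ^ 2 ≤ ∫ t in J, (ψ t - c) ^ 2 := by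
    simp only [hexp]
    rw [integral_sub hdiff (hconst _), integral_sub hsq hlin, integral_const_mul,
      integral_sub hψJ (hconst μ), hμ', setIntegral_const, setIntegral_const, hvol, smul_eq_mul,
      smul_eq_mul]
    nlinarith [mul_nonneg hba.le (sq_nonneg (μ - c))]
  rw [setLAverage_eq, Real.volume_Icc]
  refine ENNReal.div_le_of_le_mul ?_
  rw [← ENNReal.ofReal_mul (sq_nonneg ε), ← ofReal_integral_eq_lintegral_ofReal hsqμ
    (ae_of_all _ fun t => sq_nonneg _)]
  rw [← ofReal_integral_eq_lintegral_ofReal hsq (ae_of_all _ fun t => sq_nonneg _)] at hc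
  exact (ENNReal.ofReal_le_ofReal hval).trans hc

/-! ### Transfer of integrals and convergence of quantile functions -/

section Transfer

variable {X : Type*} [MeasurableSpace X] {P : Measure X} [IsProbabilityMeasure P] {g : X → ℝ}

lemma map_quantile_map (hg : Measurable g) :
    (volume.restrict (Set.Ioo 0 1)).map (quantile (P.map g)) = P.map g :=
  have : IsProbabilityMeasure (P.map g) := Measure.isProbabilityMeasure_map hg.aemeasurable
  map_quantile _

lemma map_quantile_map_Icc (hg : Measurable g) :
    (volume.restrict (Set.Icc 0 1)).map (quantile (P.map g)) = P.map g := by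
  rw [← Measure.restrict_congr_set (Ioo_ae_eq_Icc (a := (0 : ℝ)) (b := 1)), map_quantile_map hg]

lemma integral_comp_quantile (hg : Measurable g) {F : ℝ → ℝ} (hF : Measurable F) :
    ∫ t in Set.Icc (0 : ℝ) 1, F (quantile (P.map g) t) = ∫ ω, F (g ω) ∂P := by
  rw [← integral_map hg.aemeasurable hF.aestronglyMeasurable, ← map_quantile_map_Icc hg,
    integral_map (measurable_quantile _).aemeasurable hF.aestronglyMeasurable,
    map_quantile_map_Icc hg]

lemma lintegral_comp_quantile (hg : Measurable g) {F : ℝ → ℝ≥0∞} (hF : Measurable F) :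
    ∫⁻ t in Set.Icc (0 : ℝ) 1, F (quantile (P.map g) t) = ∫⁻ ω, F (g ω) ∂P := by
  rw [← lintegral_map hF hg, ← map_quantile_map_Icc hg, lintegral_map hF (measurable_quantile _),
    map_quantile_map_Icc hg]

lemma integrableOn_quantile (hg : Measurable g) (hgi : Integrable g P) :
    IntegrableOn (quantile (P.map g)) (Set.Icc 0 1) := by
  refine (integrable_map_measure (g := id) aestronglyMeasurable_id
    (measurable_quantile (P.map g)).aemeasurable).mp ?_
  rw [map_quantile_map_Icc hg]
  exact (integrable_map_measure aestronglyMeasurable_id hg.aemeasurable).mpr hgi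

end Transfer

/-- Weak convergence of laws, in the form of the inequality for open sets, implies convergence of
the quantile functions at the continuity points of the limit. -/
lemma tendsto_quantile {μ : ℕ → Measure ℝ} [∀ n, IsProbabilityMeasure (μ n)] {ν : Measure ℝ}
    [IsProbabilityMeasure ν] (h : ∀ U, IsOpen U → ν U ≤ liminf (fun n => μ n U) atTop) {t : ℝ}
    (ht : t ∈ Set.Ioo (0 : ℝ) 1) (hcont : ContinuousWithinAt (quantile ν) (Set.Ioo 0 1) t) :
    Tendsto (fun n => quantile (μ n) t) atTop (𝓝 (quantile ν t)) := by
  have hev : ∀ U, IsOpen U → ∀ c : ℝ, c < ν.real U → ∀ᶠ n in atTop, c < (μ n).real U := by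
    intro U hU c hc
    rcases lt_or_ge c 0 with hc0 | hc0
    · exact Eventually.of_forall fun n => hc0.trans_le measureReal_nonneg
    have hc' : ENNReal.ofReal c < ν U := by
      rwa [ENNReal.ofReal_lt_iff_lt_toReal hc0 (measure_ne_top _ _)]
    filter_upwards [eventually_lt_of_lt_liminf (hc'.trans_le (h U hU))] with n hn
    rwa [ENNReal.ofReal_lt_iff_lt_toReal hc0 (measure_ne_top _ _)] at hn
  have hIoi : ∀ (ρ : Measure ℝ) [IsProbabilityMeasure ρ] (y : ℝ),
      ρ.real (Set.Ioi y) = 1 - cdf ρ y := by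
    intro ρ _ y
    rw [cdf_eq_real, ← Set.compl_Iic, probReal_compl_eq_one_sub measurableSet_Iic]
  refine tendsto_order.mpr ⟨fun y hy => ?_, fun y hy => ?_⟩
  · obtain ⟨z, hyz, hz⟩ := exists_between hy
    have hlt : cdf ν z < t := by
      by_contra hcon
      exact absurd ((quantile_le_iff ht).mpr (not_lt.mp hcon)) (not_le.mpr hz)
    filter_upwards [hev (Set.Ioi z) isOpen_Ioi (1 - t) (by rw [hIoi]; linarith)] with n hn
    rw [hIoi] at hn
    refine hyz.trans (lt_of_not_ge fun hcon => ?_)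
    have := (quantile_le_iff ht).mp hcon
    linarith
  · obtain ⟨z, hz, hzy⟩ := exists_between hy
    obtain ⟨s, hts, hs, hsz⟩ : ∃ s, t < s ∧ s ∈ Set.Ioo (0 : ℝ) 1 ∧ quantile ν s < z := by
      have h1 : ∀ᶠ s in 𝓝[>] t, s ∈ Set.Ioo (0 : ℝ) 1 ∧ quantile ν s < z := by
        have h2 : 𝓝[>] t ≤ 𝓝[Set.Ioo 0 1] t := by
          rw [nhdsWithin_eq_nhds.mpr (Ioo_mem_nhds ht.1 ht.2)]
          exact nhdsWithin_le_nhds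
        exact h2 (Filter.inter_mem self_mem_nhdsWithin (hcont.eventually (gt_mem_nhds hz)))
      obtain ⟨s, hs, hs'⟩ := (h1.and self_mem_nhdsWithin).exists
      exact ⟨s, hs', hs⟩
    have hlt : t < ν.real (Set.Iio z) := by
      refine hts.trans_le (((quantile_le_iff (μ := ν) hs).mp le_rfl).trans ?_)
      rw [cdf_eq_real]
      exact measureReal_mono (Set.Iic_subset_Iio.mpr hsz)
    filter_upwards [hev (Set.Iio z) isOpen_Iio t hlt] with n hn
    refine lt_of_le_of_lt ((quantile_le_iff ht).mpr ?_) hzy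
    rw [cdf_eq_real]
    exact hn.le.trans (measureReal_mono Set.Iio_subset_Iic_self)

lemma map_le_liminf_map {X : Type*} [MeasurableSpace X] {P : Measure X} {φ : ℕ → X → ℝ}
    {g : X → ℝ} (hφ : ∀ n, Measurable (φ n)) (hg : Measurable g)
    (hlim : ∀ᵐ ω ∂P, Tendsto (fun n => φ n ω) atTop (𝓝 (g ω))) {U : Set ℝ} (hU : IsOpen U) :
    P.map g U ≤ liminf (fun n => P.map (φ n) U) atTop := by
  have hm : ∀ k : X → ℝ, Measurable k →
      P.map k U = ∫⁻ ω, (k ⁻¹' U).indicator (fun _ => (1 : ℝ≥0∞)) ω ∂P := by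
    intro k hk
    rw [Measure.map_apply hk hU.measurableSet, lintegral_indicator_const (hk hU.measurableSet),
      one_mul]
  rw [hm g hg]
  simp only [fun n => hm (φ n) (hφ n)]
  refine le_trans (lintegral_mono_ae ?_) (lintegral_liminf_le fun n =>
    measurable_const.indicator (hφ n hU.measurableSet))
  filter_upwards [hlim] with ω hω
  by_cases hmem : g ω ∈ U
  · refine le_liminf_of_le (by isBoundedDefault) ?_
    filter_upwards [hω (hU.mem_nhds hmem)] with n hn
    rw [Set.indicator_of_mem (show ω ∈ φ n ⁻¹' U from hn)]
    exact Set.indicator_le_self' (fun _ _ => zero_le) ω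
  · rw [Set.indicator_of_notMem (show ω ∉ g ⁻¹' U from hmem)]
    exact zero_le

/-- Almost sure convergence of random variables implies almost everywhere convergence of their
quantile functions. -/
lemma ae_tendsto_quantile_map {X : Type*} [MeasurableSpace X] {P : Measure X}
    [IsProbabilityMeasure P] {φ : ℕ → X → ℝ} {g : X → ℝ} (hφ : ∀ n, Measurable (φ n))
    (hg : Measurable g) (hlim : ∀ᵐ ω ∂P, Tendsto (fun n => φ n ω) atTop (𝓝 (g ω))) :
    ∀ᵐ t ∂(volume.restrict (Set.Icc (0 : ℝ) 1)),
      Tendsto (fun n => quantile (P.map (φ n)) t) atTop (𝓝 (quantile (P.map g) t)) := by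
  have : ∀ n, IsProbabilityMeasure (P.map (φ n)) := fun n =>
    Measure.isProbabilityMeasure_map (hφ n).aemeasurable
  have : IsProbabilityMeasure (P.map g) := Measure.isProbabilityMeasure_map hg.aemeasurable
  rw [← Measure.restrict_congr_set (Ioo_ae_eq_Icc (a := (0 : ℝ)) (b := 1))]
  have hcount := (monotoneOn_quantile (P.map g)).countable_not_continuousWithinAt
  filter_upwards [ae_restrict_mem measurableSet_Ioo,
    ae_restrict_of_ae (hcount.ae_notMem volume)] with t ht hnot
  refine tendsto_quantile (fun U hU => map_le_liminf_map hφ hg hlim hU) ht ?_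
  by_contra hcon
  exact hnot ⟨ht, hcon⟩

/-- Expectations converge along an almost surely convergent sequence that is bounded in `L²`; here
they are normalized to be zero. -/
lemma integral_eq_zero_of_tendsto {X : Type*} [MeasurableSpace X] {P : Measure X}
    [IsProbabilityMeasure P] {φ : ℕ → X → ℝ} {g : X → ℝ} (hφ : ∀ n, Measurable (φ n))
    (hg : Measurable g) (hlim : ∀ᵐ ω ∂P, Tendsto (fun n => φ n ω) atTop (𝓝 (g ω)))
    (hint : ∀ n, Integrable (φ n) P)
    {C : ℝ} (hC : ∀ n, ∫⁻ ω, ENNReal.ofReal (φ n ω ^ 2) ∂P ≤ ENNReal.ofReal C)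
    (h0 : ∀ n, ∫ ω, φ n ω ∂P = 0) : Integrable g P ∧ ∫ ω, g ω ∂P = 0 := by
  have hgC : ∫⁻ ω, ENNReal.ofReal (g ω ^ 2) ∂P ≤ ENNReal.ofReal C := by
    have h1 : ∫⁻ ω, ENNReal.ofReal (g ω ^ 2) ∂P ≤
        ∫⁻ ω, liminf (fun n => ENNReal.ofReal (φ n ω ^ 2)) atTop ∂P := by
      refine lintegral_mono_ae ?_
      filter_upwards [hlim] with ω hω
      exact (ENNReal.tendsto_ofReal (hω.pow 2)).liminf_eq.ge
    refine h1.trans ((lintegral_liminf_le fun n => ((hφ n).pow_const 2).ennreal_ofReal).trans ?_)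
    exact (liminf_le_liminf (Eventually.of_forall hC)).trans (by simp)
  have hsqint : ∀ k : X → ℝ, Measurable k →
      ∫⁻ ω, ENNReal.ofReal (k ω ^ 2) ∂P ≤ ENNReal.ofReal C →
      Integrable (fun ω => k ω ^ 2) P ∧ ∫ ω, k ω ^ 2 ∂P ≤ max C 0 := by
    intro k hk hkC
    refine ⟨⟨(hk.pow_const 2).aestronglyMeasurable, ?_⟩, ?_⟩
    · rw [hasFiniteIntegral_iff_ofReal (ae_of_all _ fun t => sq_nonneg _)]
      exact hkC.trans_lt ENNReal.ofReal_lt_top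
    · rw [integral_eq_lintegral_of_nonneg_ae (ae_of_all _ fun t => sq_nonneg _)
        (hk.pow_const 2).aestronglyMeasurable]
      refine (ENNReal.toReal_mono ENNReal.ofReal_ne_top hkC).trans ?_
      rw [ENNReal.toReal_ofReal']
  have hgint : Integrable g P := by
    refine Integrable.mono' ((integrable_const 1).add (hsqint g hg hgC).1) hg.aestronglyMeasurable
      (ae_of_all _ fun ω => ?_)
    simp only [Pi.add_apply, Real.norm_eq_abs]
    nlinarith [sq_abs (g ω), sq_nonneg (|g ω| - 1), abs_nonneg (g ω)]
  refine ⟨hgint, ?_⟩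
  -- truncation at the levels `±K`
  let T : ℝ → ℝ → ℝ := fun K r => max (-K) (min K r)
  have hTc : ∀ K, Continuous (T K) := fun K => by fun_prop
  have hTb : ∀ K, 0 ≤ K → ∀ r, |T K r| ≤ K := fun K hK r =>
    abs_le.mpr ⟨le_max_left _ _, max_le (by linarith) (min_le_left _ _)⟩
  have hTd : ∀ K, 0 < K → ∀ r, |r - T K r| ≤ r ^ 2 / K := by
    intro K hK r
    rw [le_div_iff₀ hK]
    simp only [T]
    rcases le_total r K with h1 | h1
    · rw [min_eq_right h1]
      rcases le_total (-K) r with h2 | h2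
      · rw [max_eq_right h2]; simp [sq_nonneg]
      · rw [max_eq_left h2, abs_of_nonpos (by linarith)]; nlinarith
    · rw [min_eq_left h1, max_eq_right (by linarith), abs_of_nonneg (by linarith)]; nlinarith
  have hTint : ∀ K, 0 ≤ K → ∀ k : X → ℝ, Measurable k → Integrable (fun ω => T K (k ω)) P :=
    fun K hK k hk => Integrable.of_bound ((hTc K).measurable.comp hk).aestronglyMeasurable K
      (ae_of_all _ fun ω => hTb K hK _)
  have hTi : ∀ K, 0 < K → ∀ k : X → ℝ, Measurable k → Integrable k P →
      ∫⁻ ω, ENNReal.ofReal (k ω ^ 2) ∂P ≤ ENNReal.ofReal C →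
      |∫ ω, k ω ∂P - ∫ ω, T K (k ω) ∂P| ≤ max C 0 / K := by
    intro K hK k hk hki hkC
    obtain ⟨h1, h2⟩ := hsqint k hk hkC
    rw [← integral_sub hki (hTint K hK.le k hk)]
    refine (abs_integral_le_integral_abs).trans ((integral_mono_of_nonneg
      (ae_of_all _ fun ω => abs_nonneg _) (h1.div_const K)
      (ae_of_all _ fun ω => hTd K hK _)).trans ?_)
    rw [integral_div]
    gcongr
  have hbound : ∀ K, 0 < K → |∫ ω, g ω ∂P| ≤ 2 * max C 0 / K := by
    intro K hK
    have hconv : Tendsto (fun n => ∫ ω, T K (φ n ω) ∂P) atTop (𝓝 (∫ ω, T K (g ω) ∂P)) := by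
      refine tendsto_integral_of_dominated_convergence (fun _ => K)
        (fun n => (hTint K hK.le _ (hφ n)).aestronglyMeasurable) (integrable_const _)
        (fun n => ae_of_all _ fun ω => hTb K hK.le _) ?_
      filter_upwards [hlim] with ω hω
      exact ((hTc K).tendsto _).comp hω
    have h1 : |∫ ω, T K (g ω) ∂P| ≤ max C 0 / K := by
      refine le_of_tendsto hconv.abs (Eventually.of_forall fun n => ?_)
      have := hTi K hK (φ n) (hφ n) (hint n) (hC n)
      rwa [h0 n, zero_sub, abs_neg] at this
    have h2 := hTi K hK g hg hgint hgC
    calc |∫ ω, g ω ∂P| = |(∫ ω, g ω ∂P - ∫ ω, T K (g ω) ∂P) + ∫ ω, T K (g ω) ∂P| := by ring_nf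
      _ ≤ max C 0 / K + max C 0 / K := (abs_add_le _ _).trans (add_le_add h2 h1)
      _ = 2 * max C 0 / K := by ring
  have hzero : Tendsto (fun K : ℝ => 2 * max C 0 / K) atTop (𝓝 0) :=
    tendsto_const_nhds.div_atTop tendsto_id
  exact abs_nonpos_iff.mp (ge_of_tendsto hzero ((eventually_gt_atTop 0).mono hbound))

/-! ### Comparison of the Bellman functions -/

section Martingale

lemma squareFunction_sq {X : Type*} (φ : ℕ → X → ℝ) (ω : X) :
    squareFunction φ ω ^ 2 = ∑' n : ℕ, ENNReal.ofReal ((φ (n + 1) ω - φ n ω) ^ 2) := by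
  rw [squareFunction, ← ENNReal.rpow_natCast, ← ENNReal.rpow_mul]
  norm_num

lemma sum_sq_le_of_squareFunction {X : Type*} {φ : ℕ → X → ℝ} {ω : X} {e : ℝ} (he : 0 ≤ e)
    (h : squareFunction φ ω ^ 2 ≤ ENNReal.ofReal e) (N : ℕ) :
    ∑ k ∈ Finset.Ico 0 N, (φ (k + 1) ω - φ k ω) ^ 2 ≤ e := by
  rw [squareFunction_sq] at h
  rw [← ENNReal.ofReal_le_ofReal_iff he, ENNReal.ofReal_sum_of_nonneg fun k _ => sq_nonneg _]
  exact (ENNReal.sum_le_tsum _).trans h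

variable {X : Type*} [m : MeasurableSpace X] {P : Measure X} {ℱ : Filtration ℕ m} {φ : ℕ → X → ℝ}

lemma measurable_squareFunction (hφ : ∀ n, Measurable (φ n)) : Measurable (squareFunction φ) :=
  (Measurable.tsum fun n =>
    (((hφ (n + 1)).sub (hφ n)).pow_const 2).ennreal_ofReal).pow_const _

lemma _root_.MeasureTheory.Martingale.measurable_process (hφ : Martingale φ ℱ P) (n : ℕ) :
    Measurable (φ n) :=
  (hφ.1 n).measurable.mono (ℱ.le n) le_rfl

lemma IsFiniteFiltration.finite_range (hℱ : IsFiniteFiltration ℱ) (hφ : Martingale φ ℱ P) (n : ℕ) :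
    (Set.range (φ n)).Finite :=
  finite_range_of_finite_measurableSet (hℱ.2 n) (hφ.1 n).measurable

lemma IsFiniteFiltration.exists_eq_const [IsProbabilityMeasure P] (hℱ : IsFiniteFiltration ℱ)
    (hφ : Martingale φ ℱ P) : ∃ x, ∀ ω, φ 0 ω = x := by
  have : Nonempty X := P.nonempty_of_neZero
  have h := hφ.1 0
  rw [hℱ.1, stronglyMeasurable_bot_iff] at h
  obtain ⟨x, hx⟩ := h
  exact ⟨x, fun ω => congrFun hx ω⟩

lemma IsFiniteFiltration.windowVarianceLE [IsProbabilityMeasure P] (hℱ : IsFiniteFiltration ℱ)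
    (hφ : Martingale φ ℱ P)
    {e : ℝ} (he : 0 ≤ e) (hS : ∀ᵐ ω ∂P, squareFunction φ ω ^ 2 ≤ ENNReal.ofReal e) (N : ℕ) :
    WindowVarianceLE (hℱ.finite_range hφ N).toFinset (fun r => P.real (φ N ⁻¹' {r})) e := by
  obtain ⟨x, hx⟩ := hℱ.exists_eq_const hφ
  have := windowVarianceLE_of_martingale hφ (hℱ.finite_range hφ) N (zero_add N)
    (MeasurableSet.univ (m := ℱ 0)) (x := x) (e := e) (fun ω _ => hx ω)
    (hS.mono fun ω hω _ => sum_sq_le_of_squareFunction he hω N)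
  simpa using this

/-- The increasing rearrangements of the terms of a martingale with square function at most `√e`
have variance at most `e` on every subinterval of `[0,1]`. -/
lemma IsFiniteFiltration.lintegral_quantile_le [IsProbabilityMeasure P]
    (hℱ : IsFiniteFiltration ℱ) (hφ : Martingale φ ℱ P)
    {e : ℝ} (he : 0 ≤ e) (hS : ∀ᵐ ω ∂P, squareFunction φ ω ^ 2 ≤ ENNReal.ofReal e) (N : ℕ)
    {a b : ℝ} (ha : 0 ≤ a) (hab : a < b) (hb : b ≤ 1) :
    ∫⁻ t in Set.Icc a b, ENNReal.ofReal ((quantile (P.map (φ N)) t -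
      ⨍ u in Set.Icc a b, quantile (P.map (φ N)) u) ^ 2) ≤ ENNReal.ofReal (e * (b - a)) :=
  (hℱ.windowVarianceLE hφ he hS N).lintegral_sub_average_sq_le (hφ.measurable_process N)
    (fun ω => by simp) (measurable_quantile _) (monotoneOn_quantile _)
    (map_quantile_map (hφ.measurable_process N)) ha hab hb

lemma IsSimple.exists_terminal_eq (h : IsSimple P φ) : ∃ N, terminal φ =ᵐ[P] φ N := by
  obtain ⟨N, hN⟩ := h
  refine ⟨N, ?_⟩
  filter_upwards [ae_all_iff.mpr fun n => ae_all_iff.mpr fun h => hN n h] with ω hω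
  have hconst : ∀ n, N ≤ n → φ n ω = φ N ω := by
    intro n hn
    induction n, hn using Nat.le_induction with
    | base => rfl
    | succ n hn ih => rw [hω n hn, ih]
  exact (tendsto_atTop_of_eventually_const hconst).limUnder_eq

lemma expectation_le_lintegral (f : ℝ → ℝ) (s : X → ℝ) (t : X → ℝ≥0∞) :
    expectation P (fun ω => H f (s ω) (t ω)) ≤
      ((∫⁻ ω, ENNReal.ofReal (f (s ω)) ∂P : ℝ≥0∞) : EReal) := by
  have h1 : ∫⁻ ω, (H f (s ω) (t ω)).toENNReal ∂P ≤ ∫⁻ ω, ENNReal.ofReal (f (s ω)) ∂P := by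
    refine lintegral_mono fun ω => ?_
    dsimp only [H]
    split_ifs
    · simp
    · simp
  rw [expectation]
  refine (EReal.sub_le_sub (EReal.coe_ennreal_le_coe_ennreal_iff.mpr h1)
    (EReal.coe_ennreal_nonneg _)).trans ?_
  simp

lemma expectation_eq_bot {f : ℝ → ℝ} {s : X → ℝ} {t : X → ℝ≥0∞} (ht : Measurable t)
    (h : ¬ ∀ᵐ ω ∂P, t ω ≤ 1) : expectation P (fun ω => H f (s ω) (t ω)) = ⊥ := by
  have hD : MeasurableSet {ω | ¬ t ω ≤ 1} := (measurableSet_le ht measurable_const).compl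
  have htop : ∫⁻ ω, (-H f (s ω) (t ω)).toENNReal ∂P = ⊤ := by
    rw [← top_le_iff]
    calc (⊤ : ℝ≥0∞) = ∫⁻ ω, {ω | ¬ t ω ≤ 1}.indicator (fun _ => (⊤ : ℝ≥0∞)) ω ∂P := by
          rw [lintegral_indicator_const hD, ENNReal.top_mul]
          exact fun h0 => h (ae_iff.mpr h0)
      _ ≤ _ := lintegral_mono fun ω => by
          by_cases hω : t ω ≤ 1
          · simp [hω]
          · simp [hω, H]
  rw [expectation, htop, EReal.coe_ennreal_top, EReal.sub_top]

theorem bellman_le_bmoBellman [IsProbabilityMeasure P] {f : ℝ → ℝ} (hf : Measurable f) {x y z : ℝ}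
    (hz : z ∈ Set.Icc (0 : ℝ) 1) :
    bellman P f x y z ≤ bmoBellman f (Real.sqrt (1 - z ^ 2)) x y := by
  refine iSup_le fun ℱ => iSup_le fun φ => iSup_le fun hℱ => iSup_le fun hφ =>
    iSup_le fun hsimple => iSup_le fun hx => iSup_le fun hy => ?_
  have hmeas := hφ.measurable_process
  by_cases hS : ∀ᵐ ω ∂P, squareFunction φ ω ^ 2 + ENNReal.ofReal (z ^ 2) ≤ 1
  swap
  · rw [expectation_eq_bot (((measurable_squareFunction hmeas).pow_const 2).add_const _) hS]
    exact bot_le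
  have he : 0 ≤ 1 - z ^ 2 := by nlinarith [hz.1, hz.2]
  have hS' : ∀ᵐ ω ∂P, squareFunction φ ω ^ 2 ≤ ENNReal.ofReal (1 - z ^ 2) := by
    filter_upwards [hS] with ω hω
    rw [ENNReal.ofReal_sub _ (sq_nonneg z), ENNReal.ofReal_one]
    exact ENNReal.le_sub_of_add_le_right ENNReal.ofReal_ne_top hω
  obtain ⟨N, hN⟩ := hsimple.exists_terminal_eq
  have hx' : ∫ ω, φ N ω ∂P = x := by rw [← hx, integral_congr_ae hN]
  have hy' : ∫ ω, φ N ω ^ 2 ∂P = y := by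
    rw [← hy]
    exact integral_congr_ae (hN.mono fun ω hω => by simp only [hω])
  have hint := integrableOn_quantile (hmeas N) (hφ.integrable N)
  refine (expectation_le_lintegral f _ _).trans ?_
  refine le_iSup_of_le (quantile (P.map (φ N))) (le_iSup_of_le hint (le_iSup_of_le ?_
    (le_iSup_of_le ?_ (le_iSup_of_le ?_ ?_))))
  · rw [integral_comp_quantile (hmeas N) (F := fun r => r) measurable_id, hx']
  · rw [integral_comp_quantile (hmeas N) (F := fun r => r ^ 2) (by fun_prop), hy']
  · refine bmoNorm_le hint (Real.sqrt_nonneg _) fun a b ha hab hb => ?_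
    rw [Real.sq_sqrt he]
    exact ⟨_, hℱ.lintegral_quantile_le hφ he hS' N ha hab hb⟩
  · rw [lintegral_comp_quantile (hmeas N) (F := fun r => ENNReal.ofReal (f r)) (by fun_prop)]
    exact EReal.coe_ennreal_le_coe_ennreal_iff.mpr
      (lintegral_congr_ae (hN.mono fun ω hω => by simp only [hω])).le

/-- The window that is the whole law gives the classical bound `E (φ N - φ 0)² ≤ e`. -/
lemma IsFiniteFiltration.lintegral_sq_le [IsProbabilityMeasure P] (hℱ : IsFiniteFiltration ℱ)
    (hφ : Martingale φ ℱ P)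
    {e : ℝ} (he : 0 ≤ e) (hS : ∀ᵐ ω ∂P, squareFunction φ ω ^ 2 ≤ ENNReal.ofReal e) {x : ℝ} {N : ℕ}
    (hx : ∫ ω, φ N ω ∂P = x) :
    ∫⁻ ω, ENNReal.ofReal ((φ N ω - x) ^ 2) ∂P ≤ ENNReal.ofReal e := by
  have hmeas := hφ.measurable_process N
  have h := hℱ.lintegral_quantile_le hφ he hS N le_rfl zero_lt_one le_rfl
  have havg : ⨍ u in Set.Icc (0 : ℝ) 1, quantile (P.map (φ N)) u = x := by
    rw [setAverage_eq, integral_comp_quantile hmeas (F := fun r => r) measurable_id, hx]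
    simp
  rwa [havg, sub_zero, mul_one, lintegral_comp_quantile hmeas
    (F := fun r => ENNReal.ofReal ((r - x) ^ 2)) (by fun_prop)] at h

theorem martingaleSup_le_bmoSup [IsProbabilityMeasure P] {f : ℝ → ℝ} (hf : Measurable f)
    (x : ℝ) : martingaleSup P f x ≤ bmoSup f x := by
  refine iSup_le fun ℱ => iSup_le fun φ => iSup_le fun hℱ => iSup_le fun hφ => iSup_le fun hφ0 =>
    iSup_le fun hS => ?_
  have hmeas := hφ.measurable_process
  have hS' : ∀ᵐ ω ∂P, squareFunction φ ω ^ 2 ≤ ENNReal.ofReal 1 :=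
    hS.mono fun ω hω => by
      rw [ENNReal.ofReal_one]
      exact pow_le_one₀ zero_le hω
  have hmean : ∀ n, ∫ ω, φ n ω ∂P = x := by
    intro n
    have h1 := hφ.setIntegral_eq (Nat.zero_le n) (MeasurableSet.univ (m := ℱ 0))
    rw [setIntegral_univ, setIntegral_univ] at h1
    rw [← h1, integral_congr_ae hφ0]
    simp
  have hvar : ∀ n, ∫⁻ ω, ENNReal.ofReal ((φ n ω - x) ^ 2) ∂P ≤ ENNReal.ofReal 1 := fun n =>
    hℱ.lintegral_sq_le hφ zero_le_one hS' (hmean n)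
  -- the martingale is bounded in `L¹`
  have hL1 : ∀ n, ∫⁻ ω, ‖φ n ω‖ₑ ∂P ≤ ENNReal.ofReal (2 + |x|) := by
    intro n
    calc ∫⁻ ω, ‖φ n ω‖ₑ ∂P ≤
        ∫⁻ ω, (ENNReal.ofReal ((φ n ω - x) ^ 2) + ENNReal.ofReal (1 + |x|)) ∂P := by
          refine lintegral_mono fun ω => ?_
          rw [← ENNReal.ofReal_add (sq_nonneg _) (by positivity), ← ofReal_norm,
            Real.norm_eq_abs]
          refine ENNReal.ofReal_le_ofReal ?_
          have h1 : |φ n ω| ≤ |φ n ω - x| + |x| := by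
            simpa using abs_add_le (φ n ω - x) x
          nlinarith [sq_abs (φ n ω - x), sq_nonneg (|φ n ω - x| - 1), abs_nonneg (φ n ω - x)]
      _ ≤ ENNReal.ofReal 1 + ENNReal.ofReal (1 + |x|) := by
          rw [lintegral_add_right _ measurable_const]
          simpa using hvar n
      _ = ENNReal.ofReal (2 + |x|) := by
          rw [← ENNReal.ofReal_add zero_le_one (by positivity)]
          ring_nf
  have hconv : ∀ᵐ ω ∂P, ∃ c, Tendsto (fun n => φ n ω) atTop (𝓝 c) :=
    hφ.submartingale.exists_ae_tendsto_of_bdd (R := (2 + |x|).toNNReal) fun n => by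
      rw [eLpNorm_one_eq_lintegral_enorm]
      exact hL1 n
  obtain ⟨g, hg, hlim⟩ := measurable_limit_of_tendsto_metrizable_ae
    (fun n => (hmeas n).aemeasurable) hconv
  have hterm : terminal φ =ᵐ[P] g := hlim.mono fun ω hω => hω.limUnder_eq
  obtain ⟨hgi, hgx⟩ := integral_eq_zero_of_tendsto (P := P) (φ := fun n ω => φ n ω - x)
    (g := fun ω => g ω - x) (fun n => (hmeas n).sub_const x) (hg.sub_const x)
    (hlim.mono fun ω hω => hω.sub_const x) (fun n => (hφ.integrable n).sub (integrable_const x))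
    hvar (fun n => by
      rw [integral_sub (hφ.integrable n) (integrable_const x), hmean n]
      simp)
  have hgi' : Integrable g P := by
    have := hgi.add (integrable_const x)
    refine this.congr (ae_of_all _ fun ω => ?_)
    simp
  have hgx' : ∫ ω, g ω ∂P = x := by
    rw [integral_sub hgi' (integrable_const x)] at hgx
    simp only [integral_const, probReal_univ, one_smul] at hgx
    linarith
  have hint := integrableOn_quantile hg hgi'
  refine le_iSup_of_le (quantile (P.map g)) (le_iSup_of_le hint (le_iSup_of_le ?_
    (le_iSup_of_le ?_ ?_)))
  · rw [integral_comp_quantile hg (F := fun r => r) measurable_id, hgx']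
  · rw [← ENNReal.ofReal_one]
    refine bmoNorm_le hint zero_le_one fun a b ha hab hb => ?_
    have hsub : Set.Icc a b ⊆ Set.Icc 0 1 := Set.Icc_subset_Icc ha hb
    have hlimψ := ae_restrict_of_ae_restrict_of_subset hsub (ae_tendsto_quantile_map hmeas hg hlim)
    set c : ℕ → ℝ := fun n => ⨍ u in Set.Icc a b, quantile (P.map (φ n)) u with hc
    have hcb : ∀ n, c n ∈ Metric.closedBall (0 : ℝ) ((b - a)⁻¹ * (2 + |x|)) := by
      intro n
      rw [mem_closedBall_zero_iff]
      simp only [hc]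
      rw [setAverage_eq, norm_smul, Real.volume_real_Icc,
        max_eq_left (by linarith), norm_inv, Real.norm_of_nonneg (by linarith)]
      refine mul_le_mul_of_nonneg_left ?_ (inv_nonneg.mpr (by linarith))
      rw [← ENNReal.ofReal_le_ofReal_iff (by positivity), ofReal_norm]
      refine (enorm_integral_le_lintegral_enorm _).trans ((lintegral_mono_set hsub).trans ?_)
      rw [lintegral_comp_quantile (hmeas n) (F := fun r => ‖r‖ₑ) (by fun_prop)]
      exact hL1 n
    obtain ⟨c', -, k, hk, hkc⟩ := tendsto_subseq_of_bounded Metric.isBounded_closedBall hcb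
    refine ⟨c', ?_⟩
    calc ∫⁻ t in Set.Icc a b, ENNReal.ofReal ((quantile (P.map g) t - c') ^ 2) ≤
        ∫⁻ t in Set.Icc a b, liminf (fun i =>
          ENNReal.ofReal ((quantile (P.map (φ (k i))) t - c (k i)) ^ 2)) atTop := by
          refine lintegral_mono_ae ?_
          filter_upwards [hlimψ] with t ht
          exact (ENNReal.tendsto_ofReal
            (((ht.comp hk.tendsto_atTop).sub hkc).pow 2)).liminf_eq.ge
      _ ≤ liminf (fun i => ∫⁻ t in Set.Icc a b,
          ENNReal.ofReal ((quantile (P.map (φ (k i))) t - c (k i)) ^ 2)) atTop :=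
          lintegral_liminf_le fun i =>
            (((measurable_quantile _).sub_const _).pow_const 2).ennreal_ofReal
      _ ≤ liminf (fun _ : ℕ => ENNReal.ofReal (1 * (b - a))) atTop :=
          liminf_le_liminf (Eventually.of_forall fun i =>
            hℱ.lintegral_quantile_le hφ zero_le_one hS' (k i) ha hab hb)
      _ = ENNReal.ofReal (1 ^ 2 * (b - a)) := by simp
  · rw [lintegral_comp_quantile hg (F := fun r => ENNReal.ofReal (f r)) (by fun_prop)]
    exact (lintegral_congr_ae (hterm.mono fun ω hω => by simp only [hω])).le

end Martingale

end SquareBellman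

theorem mainTheorem6 {X : Type*} [MeasurableSpace X] (P : MeasureTheory.Measure X)
    [MeasureTheory.IsProbabilityMeasure P] (f : ℝ → ℝ) (hf : Measurable f)
    (hf_nonneg : ∀ t, 0 ≤ f t) :
    (∀ x y z : ℝ, (x, y, z) ∈ SquareBellman.Omega →
      SquareBellman.bellman P f x y z ≤ SquareBellman.bmoBellman f (Real.sqrt (1 - z ^ 2)) x y) ∧
    (∀ x : ℝ, SquareBellman.martingaleSup P f x ≤ SquareBellman.bmoSup f x) :=
  ⟨fun _ _ _ h => SquareBellman.bellman_le_bmoBellman hf h.2.2,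
    fun x => SquareBellman.martingaleSup_le_bmoSup hf x⟩
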